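/- All graphs are finite and simple. A \emph{complete set of $k$-sets} on $V$ is a pair $(\mathcal S_k,\overline{\mathcal S}_k)$ of disjoint families whose union is the family of all $k$-element subsets of $V$. A graph $G$ on $V$ is \emph{consistent} with it if $\mathcal S_k$ is exactly the family of $k$-subsets of $V$ inducing a connected subgraph of $G$, and $\overline{\mathcal S}_k$ exactly the family of those inducing a disconnected subgraph. A \emph{partial graph} $H$ on $V$ is a partition of $\binom V2$ into edges $E(H)$, non-edges $E_N(H)$ and unknown edges $E_U(H)$; a graph $G$ on $V$ is a \emph{supergraph} of $H$ if $E(H)\subseteq E(G)$ and $E_N(H)\cap E(G)=\emptyset$. A \emph{skeleton} on $V$ is a partial graph $H$ with pairwise disjoint sets $V_1,\dots,V_m\subseteq V$ such that $E_U(H)=\bigcup_{i=1}^m\binom{V_i}{2}$, and, for each $i$, a collection $\mathcal C_i$ of graphs on $V_i$. Its \emph{width} is $\max_i |V_i|$ ($0$ if $m=0$). A graph $G$ on $V$ is a \emph{completion} of the skeleton if $G$ is a supergraph of $H$ and $G[V_i]\in\mathcal C_i$ for every $i$. \textbf{Theorem.} Let $k\ge 2$ and $d\ge 1$ be integers. There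 are a constant $N$ and a polynomial $p$, both depending only on $k$ and $d$, and an algorithm which, given $n$ and any complete set of $k$-sets $(\mathcal S_k,\overline{\mathcal S}_k)$ on a vertex set $V$ with $|V|=n$ (both families being listed explicitly), computes in time at most $p(n)$ a family $\mathcal F$ of at most $N$ skeletons on $V$, each of width at most $d$ and with its collections listed explicitly, such that the completions of the skeletons in $\mathcal F$ are exactly the connected graphs on $V$ of maximum degree at most $d$ that are consistent with $(\mathcal S_k,\overline{\mathcal S}_k)$. In particular, a connected graph on $V$ of maximum degree at most $d$ is consistent with $(\mathcal S_k,\overline{\mathcal S}_k)$ if and only if it is a completion of a skeleton in $\mathcal F$. -/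

import Mathlib

/-! ### Graphs, partial graphs, connected `k`-sets and skeletons -/

/-- A partial graph on `V`. A set of two-element subsets of `V` is the same thing as a simple
graph on `V`, so the known edges, the known non-edges and the unknown edges are given as three
simple graphs, which partition the pairs of distinct vertices. -/
structure PartialGraph (V : Type) where
  edges : SimpleGraph V
  nonEdges : SimpleGraph V
  unknown : SimpleGraph V
  edges_disjoint_nonEdges : Disjoint edges nonEdges
  edges_disjoint_unknown : Disjoint edges unknown
  nonEdges_disjoint_unknown : Disjoint nonEdges unknown
  cover : edges ⊔ nonEdges ⊔ unknown = ⊤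

/-- `G` is a supergraph of `H`: every known edge of `H` is an edge of `G` and every known
non-edge of `H` is a non-edge of `G`. -/
def PartialGraph.IsSupergraph {V : Type} (H : PartialGraph V) (G : SimpleGraph V) : Prop :=
  H.edges ≤ G ∧ H.nonEdges ≤ Gᶜ

/-- A skeleton: a partial graph, pairwise disjoint vertex sets `V₁, …, Vₘ` such that the unknown
edges are exactly the pairs inside some `Vᵢ`, and for each `i` a collection of graphs on `Vᵢ`. -/
structure Skeleton (V : Type) extends PartialGraph V where
  m : ℕ
  part : Fin m → Finset V
  parts_disjoint : ∀ i j, i ≠ j → Disjoint (part i) (part j)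
  unknown_adj_iff : ∀ u v, unknown.Adj u v ↔ u ≠ v ∧ ∃ i, u ∈ part i ∧ v ∈ part i
  collection : ∀ i, Set (SimpleGraph (part i : Set V))

/-- The width: the largest size of a part (`0` if there is no part). -/
def Skeleton.width {V : Type} (s : Skeleton V) : ℕ :=
  Finset.univ.sup fun i => (s.part i).card

/-- `G` is a completion of the skeleton `s`. -/
def Skeleton.IsCompletion {V : Type} (s : Skeleton V) (G : SimpleGraph V) : Prop :=
  ∃ C : ∀ i, SimpleGraph (s.part i : Set V), (∀ i, C i ∈ s.collection i) ∧
    s.toPartialGraph.IsSupergraph G ∧ ∀ i, G.induce (s.part i : Set V) = C i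

/-- A complete set of `k`-sets on `V`: every `k`-subset of `V` is declared either connected or
disconnected, and not both. -/
structure CompleteKSets (k : ℕ) (V : Type) where
  conn : Finset (Finset V)
  disconn : Finset (Finset V)
  disjoint : Disjoint conn disconn
  cover : ∀ S : Finset V, (S ∈ conn ∨ S ∈ disconn) ↔ S.card = k

/-- The `k`-subsets of `V` that induce a connected subgraph of `G`. -/
def connectedSets {V : Type} (k : ℕ) (G : SimpleGraph V) : Set (Finset V) :=
  {S | S.card = k ∧ (G.induce (S : Set V)).Connected}

/-- The `k`-subsets of `V` that induce a disconnected subgraph of `G`. -/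
def disconnectedSets {V : Type} (k : ℕ) (G : SimpleGraph V) : Set (Finset V) :=
  {S | S.card = k ∧ ¬ (G.induce (S : Set V)).Connected}

/-- The graph `G` is consistent with the given `k`-sets. -/
def CompleteKSets.Consistent {k : ℕ} {V : Type} (K : CompleteKSets k V) (G : SimpleGraph V) :
    Prop :=
  connectedSets k G = (K.conn : Set (Finset V)) ∧
    disconnectedSets k G = (K.disconn : Set (Finset V))

/-! ### The machine model

Programs of a one-variable WHILE language over binary trees. The current value is a tree, and
executing one construct of the language is charged the size of the current value, so that running
time is polynomially related to the running time of a (multi-tape) Turing machine, in both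
directions. -/

/-- Binary trees, the data on which programs operate. -/
inductive Data where
  | nil : Data
  | cons : Data → Data → Data

/-- The number of nodes of a tree, leaves included. -/
def Data.size : Data → ℕ
  | .nil => 1
  | .cons a b => a.size + b.size + 1

/-- The left subtree (`nil` for `nil`). -/
def Data.head : Data → Data
  | .nil => .nil
  | .cons a _ => a

/-- The right subtree (`nil` for `nil`). -/
def Data.tail : Data → Data
  | .nil => .nil
  | .cons _ b => b

/-- Programs: `comp p q` runs `p` and then `q`; `cond c p q` runs `p` if the value of `c` is not
`nil` and `q` otherwise; `loop c p` repeats `p` as long as the value of `c` is not `nil`. -/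
inductive Program where
  | nil : Program
  | id : Program
  | head : Program
  | tail : Program
  | cons : Program → Program → Program
  | comp : Program → Program → Program
  | cond : Program → Program → Program → Program
  | loop : Program → Program → Program

/-- `p.Runs x y t`: on input `x` the program `p` halts with output `y` after time `t`. -/
inductive Program.Runs : Program → Data → Data → ℕ → Prop where
  | nil (x : Data) : Runs .nil x .nil x.size
  | id (x : Data) : Runs .id x x x.size
  | head (x : Data) : Runs .head x x.head x.size
  | tail (x : Data) : Runs .tail x x.tail x.size
  | cons {p q : Program} {x a b : Data} {s t : ℕ} :
      Runs p x a s → Runs q x b t → Runs (.cons p q) x (.cons a b) (x.size + s + t)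
  | comp {p q : Program} {x y z : Data} {s t : ℕ} :
      Runs p x y s → Runs q y z t → Runs (.comp p q) x z (x.size + s + t)
  | cond_true {c p q : Program} {x a b y : Data} {s t : ℕ} :
      Runs c x (.cons a b) s → Runs p x y t → Runs (.cond c p q) x y (x.size + s + t)
  | cond_false {c p q : Program} {x y : Data} {s t : ℕ} :
      Runs c x .nil s → Runs q x y t → Runs (.cond c p q) x y (x.size + s + t)
  | loop_done {c p : Program} {x : Data} {s : ℕ} :
      Runs c x .nil s → Runs (.loop c p) x x (x.size + s)
  | loop_step {c p : Program} {x a b y z : Data} {s t r : ℕ} :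
      Runs c x (.cons a b) s → Runs p x y t → Runs (.loop c p) y z r →
        Runs (.loop c p) x z (x.size + s + t + r)

/-! ### Encodings of inputs and outputs

Vertex sets are encoded as bit vectors and graphs as adjacency matrices. -/

/-- A list as a tree. -/
def encodeList {α : Type} (f : α → Data) : List α → Data
  | [] => .nil
  | a :: l => .cons (f a) (encodeList f l)

/-- A bit as a tree. -/
def encodeBool : Bool → Data
  | false => .nil
  | true => .cons .nil .nil

/-- A natural number in unary. -/
def encodeNat (n : ℕ) : Data :=
  encodeList (fun _ => Data.nil) (List.range n)

/-- A vertex set as a bit vector of length `n`. -/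
def encodeSet {n : ℕ} (S : Finset (Fin n)) : Data :=
  encodeList (fun v => encodeBool (decide (v ∈ S))) (List.finRange n)

open Classical in
/-- A graph as its `n × n` adjacency matrix. -/
noncomputable def encodeGraph {n : ℕ} (G : SimpleGraph (Fin n)) : Data :=
  encodeList (fun u => encodeList (fun v => encodeBool (decide (G.Adj u v))) (List.finRange n))
    (List.finRange n)

/-- A graph on a set of vertices, as an `n × n` adjacency matrix. -/
noncomputable def encodeGraphOn {n : ℕ} {A : Set (Fin n)} (C : SimpleGraph A) : Data :=
  encodeGraph (C.map (Function.Embedding.subtype (· ∈ A)))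

/-- `x` encodes the number of vertices together with the connected and the disconnected `k`-sets,
each listed once and in any order. -/
def CompleteKSets.IsEncoding {k n : ℕ} (K : CompleteKSets k (Fin n)) (x : Data) : Prop :=
  ∃ l₁ l₂ : List (Finset (Fin n)), l₁.Nodup ∧ l₂.Nodup ∧
    (∀ S, S ∈ l₁ ↔ S ∈ K.conn) ∧ (∀ S, S ∈ l₂ ↔ S ∈ K.disconn) ∧
    x = .cons (encodeNat n) (.cons (encodeList encodeSet l₁) (encodeList encodeSet l₂))

/-- The three adjacency matrices of a partial graph. -/
noncomputable def encodePartialGraph {n : ℕ} (H : PartialGraph (Fin n)) : Data :=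
  .cons (encodeGraph H.edges) (.cons (encodeGraph H.nonEdges) (encodeGraph H.unknown))

/-- `y` encodes the skeleton `s`: its partial graph and, for each part, the part and a list of the
graphs in its collection, in any order. -/
def Skeleton.IsEncoding {n : ℕ} (s : Skeleton (Fin n)) (y : Data) : Prop :=
  ∃ L : ∀ i, List (SimpleGraph (s.part i : Set (Fin n))),
    (∀ i C, C ∈ L i ↔ C ∈ s.collection i) ∧
    y = .cons (encodePartialGraph s.toPartialGraph)
      (encodeList (fun i => .cons (encodeSet (s.part i)) (encodeList encodeGraphOn (L i)))
        (List.finRange s.m))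

/-- `y` encodes the family `F` of skeletons, as a list. -/
def IsFamilyEncoding {n : ℕ} (F : List (Skeleton (Fin n))) (y : Data) : Prop :=
  ∃ ys : List Data, List.Forall₂ Skeleton.IsEncoding F ys ∧ y = encodeList (fun z => z) ys

/-!
A connected set `X` with at least `k - 1` vertices touches a vertex `x` outside it exactly when
some connected `k`-set contains `x` and otherwise lies in `X` (`touch_iff_adj`). So from the given
sets one can grow connected sets without knowing the graph, as long as they stay large. Fix a root
set `E`, the first connected `k`-set (or all vertices, if there are fewer than `k`), and consider
only connected sets containing `E`.

For a vertex `w` not in or next to `E` let its shadow be what `E` reaches outside the closed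
neighbourhood of `w`. A vertex `u` next to the shadow but not in it is adjacent to `w`, and a
vertex in the shadow is not. Hence the adjacency of `u` and `w` is determined unless neither is in
or next to the shadow of the other. This relation `Cls` is an equivalence relation (`Cls.trans`);
its classes have at most `d` elements, because all vertices of a class are adjacent to the vertex
through which a set growing from `E` first touches the class (`exists_common_neighbor`). The
classes are the parts of the skeletons. The edges in the closed neighbourhood of `E`, a set of at
most `k + k * d` vertices, are guessed, which is where the bounded number of skeletons comes from.

It remains to see that the constraints on different classes are independent. Changing the graph
inside classes does not change what `E` reaches inside any given set (`IsVariant.reach_step`). If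
some connected set containing `E` touches the class of `u` but not that of `w`, then a connected
set meeting both classes contains or touches the whole class of `w` without using edges inside
classes (`exists_core_adj_of_sep`). It follows that a set `S` is connected in a variant of the
graph if it is connected whenever all classes but one are completed (`IsVariant.cn_of_forall`),
and disconnected if it is disconnected whenever all classes but one are emptied
(`IsVariant.not_cn_of_forall`). These are conditions on one class at a time, so they define the
collections, and they are tested by trying the boundedly many graphs on each class. A guess is
kept if combining the first members of its collections gives a consistent graph; this graph then
certifies that the classes were computed from the sets of an actual graph, so that the argument
above applies to all completions.

For the running time, data of each type are represented by trees (`Enc`), and `PolyTime` is shown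
to be closed under composition, case distinction and folds over lists whose state grows by a
bounded amount in each step (`PolyTime.foldl`). The algorithm is written as a function on lists
and numbers within this closure.
-/

/-! ### Polynomial-time functions -/

/-- A type whose elements are represented by trees. Injectivity is not needed. -/
class Enc (α : Type) where
  /-- The tree representing an element. -/
  enc : α → Data

open Enc

instance : Enc Unit := ⟨fun _ => .nil⟩
instance : Enc Bool := ⟨encodeBool⟩
instance : Enc ℕ := ⟨encodeNat⟩
instance {α β : Type} [Enc α] [Enc β] : Enc (α × β) := ⟨fun p => .cons (enc p.1) (enc p.2)⟩
instance {α : Type} [Enc α] : Enc (List α) := ⟨encodeList enc⟩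

/-- The size of the tree representing an element. -/
def esize {α : Type} [Enc α] (a : α) : ℕ := (enc a).size

/-- `f` is computed by a program in time polynomial in the size of the tree representing the
argument. -/
@[fun_prop]
def PolyTime {α β : Type} [Enc α] [Enc β] (f : α → β) : Prop :=
  ∃ (P : Program) (p : Polynomial ℕ), ∀ a, ∃ t, P.Runs (enc a) (enc (f a)) t ∧
    t ≤ p.eval (esize a)

theorem Data.one_le_size (x : Data) : 1 ≤ x.size := by
  cases x <;> simp [Data.size]

theorem Data.size_head_le (x : Data) : x.head.size ≤ x.size := by
  cases x <;> simp [Data.size, Data.head]; omega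

theorem Data.size_tail_le (x : Data) : x.tail.size ≤ x.size := by
  cases x <;> simp [Data.size, Data.tail]; omega

/-- Writing the output takes time. -/
theorem Program.Runs.size_le {P : Program} {x y : Data} {t : ℕ} (h : P.Runs x y t) :
    y.size ≤ t := by
  induction h with
  | nil x => exact x.one_le_size
  | id x => exact le_rfl
  | head x => exact x.size_head_le
  | tail x => exact x.size_tail_le
  | @cons p q x a b s t _ _ h1 h2 =>
    have := x.one_le_size
    simp only [Data.size]; omega
  | comp _ _ _ _ => omega
  | cond_true _ _ _ _ => omega
  | cond_false _ _ _ _ => omega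
  | loop_done _ _ => omega
  | loop_step _ _ _ _ _ _ => omega

theorem Polynomial.eval_nat_mono (p : Polynomial ℕ) {a b : ℕ} (h : a ≤ b) :
    p.eval a ≤ p.eval b := by
  simp only [Polynomial.eval_eq_sum, Polynomial.sum]
  gcongr

section
variable {α β γ σ : Type} [Enc α] [Enc β] [Enc γ] [Enc σ]

@[simp] theorem esize_prod (p : α × β) : esize p = esize p.1 + esize p.2 + 1 := rfl
@[simp] theorem esize_nil : esize ([] : List α) = 1 := rfl
@[simp] theorem esize_cons (a : α) (l : List α) : esize (a :: l) = esize a + esize l + 1 := rfl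

theorem esize_bool_le (b : Bool) : esize b ≤ 3 := by
  cases b <;> simp [esize, enc, encodeBool, Data.size]

theorem length_lt_esize (l : List α) : l.length < esize l := by
  induction l with
  | nil => simp
  | cons a l ih => simp only [List.length_cons, esize_cons]; omega

theorem esize_le_of_mem {a : α} {l : List α} (h : a ∈ l) : esize a ≤ esize l := by
  induction l with
  | nil => simp at h
  | cons b l ih =>
    simp only [esize_cons]
    rcases List.mem_cons.1 h with rfl | h
    · omega
    · have := ih h; omega

theorem esize_append (l l' : List α) : esize (l ++ l') ≤ esize l + esize l' := by
  induction l with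
  | nil => simp
  | cons a l ih => simp only [List.cons_append, esize_cons]; omega

namespace PolyTime

theorem esize_le {f : α → β} (hf : PolyTime f) :
    ∃ p : Polynomial ℕ, ∀ a, esize (f a) ≤ p.eval (esize a) := by
  obtain ⟨P, p, h⟩ := hf
  refine ⟨p, fun a => ?_⟩
  obtain ⟨t, h1, h2⟩ := h a
  exact h1.size_le.trans h2

@[fun_prop]
theorem id : PolyTime (fun a : α => a) :=
  ⟨.id, .X, fun _ => ⟨_, .id _, by simp [esize]⟩⟩

@[fun_prop]
theorem comp {g : β → γ} {f : α → β} (hg : PolyTime g) (hf : PolyTime f) :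
    PolyTime (fun a => g (f a)) := by
  obtain ⟨P, p, hP⟩ := hf
  obtain ⟨Q, q, hQ⟩ := hg
  refine ⟨.comp P Q, .X + p + q.comp p, fun a => ?_⟩
  obtain ⟨s, hs, hs'⟩ := hP a
  obtain ⟨t, ht, ht'⟩ := hQ (f a)
  refine ⟨_, .comp hs ht, ?_⟩
  have := q.eval_nat_mono (hs.size_le.trans hs')
  simp only [Polynomial.eval_add, Polynomial.eval_X, Polynomial.eval_comp, esize] at *
  omega

theorem exists_runs_const (y : Data) : ∃ (P : Program) (c : ℕ), ∀ x : Data, ∃ t,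
    P.Runs x y t ∧ t ≤ c * x.size := by
  induction y with
  | nil => exact ⟨.nil, 1, fun x => ⟨_, .nil x, by simp⟩⟩
  | cons a b iha ihb =>
    obtain ⟨P, c, hP⟩ := iha
    obtain ⟨Q, e, hQ⟩ := ihb
    refine ⟨.cons P Q, c + e + 1, fun x => ?_⟩
    obtain ⟨s, hs, hs'⟩ := hP x
    obtain ⟨t, ht, ht'⟩ := hQ x
    exact ⟨_, .cons hs ht, by nlinarith⟩

@[fun_prop]
theorem const (b : β) : PolyTime (fun _ : α => b) := by
  obtain ⟨P, c, h⟩ := exists_runs_const (enc b)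
  refine ⟨P, .C c * .X, fun a => ?_⟩
  obtain ⟨t, h1, h2⟩ := h (enc a)
  exact ⟨t, h1, by simpa [esize] using h2⟩

@[fun_prop]
theorem prodMk {f : α → β} {g : α → γ} (hf : PolyTime f) (hg : PolyTime g) :
    PolyTime (fun a => (f a, g a)) := by
  obtain ⟨P, p, hP⟩ := hf
  obtain ⟨Q, q, hQ⟩ := hg
  refine ⟨.cons P Q, .X + p + q, fun a => ?_⟩
  obtain ⟨s, hs, hs'⟩ := hP a
  obtain ⟨t, ht, ht'⟩ := hQ a
  refine ⟨_, .cons hs ht, ?_⟩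
  simp only [Polynomial.eval_add, Polynomial.eval_X, esize] at *
  omega

@[fun_prop]
theorem fst : PolyTime (Prod.fst : α × β → α) :=
  ⟨.head, .X, fun _ => ⟨_, .head _, by simp [esize]⟩⟩

@[fun_prop]
theorem snd : PolyTime (Prod.snd : α × β → β) :=
  ⟨.tail, .X, fun _ => ⟨_, .tail _, by simp [esize]⟩⟩

/-- A case distinction on whether the tree representing `c a` is `nil`. -/
theorem cond_aux {c : α → γ} {f g h : α → β} (hc : PolyTime c) (hf : PolyTime f)
    (hg : PolyTime g) (h1 : ∀ a, enc (c a) ≠ .nil → h a = f a)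
    (h2 : ∀ a, enc (c a) = .nil → h a = g a) : PolyTime h := by
  obtain ⟨R, r, hR⟩ := hc
  obtain ⟨P, p, hP⟩ := hf
  obtain ⟨Q, q, hQ⟩ := hg
  refine ⟨.cond R P Q, .X + r + p + q, fun a => ?_⟩
  obtain ⟨u, hu, hu'⟩ := hR a
  obtain ⟨s, hs, hs'⟩ := hP a
  obtain ⟨t, ht, ht'⟩ := hQ a
  rcases hca : enc (c a) with _ | ⟨y, z⟩
  · rw [hca] at hu
    refine ⟨_, by rw [h2 a hca]; exact .cond_false hu ht, ?_⟩
    simp only [Polynomial.eval_add, Polynomial.eval_X, esize] at *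
    omega
  · rw [hca] at hu
    refine ⟨_, by rw [h1 a (by simp [hca])]; exact .cond_true hu hs, ?_⟩
    simp only [Polynomial.eval_add, Polynomial.eval_X, esize] at *
    omega

@[fun_prop]
theorem cond {c : α → Bool} {f g : α → β} (hc : PolyTime c) (hf : PolyTime f)
    (hg : PolyTime g) : PolyTime (fun a => bif c a then f a else g a) := by
  refine cond_aux hc hf hg (fun a h => ?_) (fun a h => ?_) <;>
    cases hca : c a <;> simp_all [enc, encodeBool]

@[fun_prop]
theorem and {f g : α → Bool} (hf : PolyTime f) (hg : PolyTime g) :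
    PolyTime (fun a => f a && g a) := by
  have : PolyTime (fun a => bif f a then g a else false) := by fun_prop
  simpa using this

@[fun_prop]
theorem or {f g : α → Bool} (hf : PolyTime f) (hg : PolyTime g) :
    PolyTime (fun a => f a || g a) := by
  have : PolyTime (fun a => bif f a then true else g a) := by fun_prop
  simpa using this

@[fun_prop]
theorem not {f : α → Bool} (hf : PolyTime f) : PolyTime (fun a => !f a) := by
  have : PolyTime (fun a => bif f a then false else true) := by fun_prop
  simpa using this

@[fun_prop]
theorem list_cons {f : α → β} {g : α → List β} (hf : PolyTime f) (hg : PolyTime g) :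
    PolyTime (fun a => f a :: g a) :=
  prodMk hf hg

@[fun_prop]
theorem list_tail {f : α → List β} (hf : PolyTime f) : PolyTime (fun a => (f a).tail) := by
  have : PolyTime (List.tail : List β → List β) :=
    ⟨.tail, .X, fun l => ⟨(enc l).size, by cases l <;> exact .tail _, by simp [esize]⟩⟩
  exact this.comp hf

@[fun_prop]
theorem list_headD {f : α → List β} (hf : PolyTime f) (b : β) :
    PolyTime (fun a => (f a).headD b) := by
  have hQ := const (α := List β) b
  obtain ⟨Q, q, hQ⟩ := hQ
  have : PolyTime (fun l : List β => l.headD b) := by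
    refine ⟨.cond .id .head Q, .X + .X + .X + q, fun l => ?_⟩
    cases l with
    | nil =>
      obtain ⟨t, ht, ht'⟩ := hQ []
      refine ⟨_, .cond_false (.id _) ht, ?_⟩
      simp only [Polynomial.eval_add, Polynomial.eval_X, esize] at *
      omega
    | cons c l =>
      refine ⟨_, .cond_true (.id _) (.head _), ?_⟩
      simp only [Polynomial.eval_add, Polynomial.eval_X, esize] at *
      omega
  exact this.comp hf

@[fun_prop]
theorem list_isEmpty {f : α → List β} (hf : PolyTime f) : PolyTime (fun a => (f a).isEmpty) := by
  refine cond_aux hf (const false) (const true) (fun a h => ?_) (fun a h => ?_) <;>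
    cases hfa : f a <;> simp_all [enc, encodeList]

/-- One step of a fold, applied to context, remaining list and state. -/
theorem fold_step {step : α → σ → β → σ}
    (hstep : PolyTime (fun q : α × σ × β => step q.1 q.2.1 q.2.2)) :
    PolyTime (fun q : α × (β × List β) × σ => (q.1, q.2.1.2, step q.1 q.2.2 q.2.1.1)) := by
  have h : PolyTime (fun q : α × (β × List β) × σ => (q.1, q.2.2, q.2.1.1)) := by fun_prop
  have := hstep.comp h
  fun_prop

/-- The loop of a fold, with a time bound in terms of a bound `W` on the sizes of the intermediate
states. -/
theorem exists_runs_fold {step : α → σ → β → σ}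
    (hstep : PolyTime (fun q : α × σ × β => step q.1 q.2.1 q.2.2)) :
    ∃ (P : Program) (p : Polynomial ℕ), ∀ (a : α) (W : ℕ) (l : List β) (s : σ),
      (∀ l', l' <+: l → esize (l'.foldl (step a) s) ≤ W) →
      ∀ Z, esize a + esize l + W + 2 ≤ Z →
      ∃ t, P.Runs (enc (a, l, s)) (enc (a, ([] : List β), l.foldl (step a) s)) t ∧
        t ≤ (l.length + 1) * p.eval Z := by
  obtain ⟨P, p, hP⟩ := fold_step hstep
  refine ⟨.loop (.comp .tail .head) P, p + .C 4 * .X, fun a W l => ?_⟩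
  induction l with
  | nil =>
    intro s hW Z hZ
    have h1 := hW [] (by simp)
    have h2 : (enc (a, ([] : List β), s)).size ≤ Z := by
      change esize (a, ([] : List β), s) ≤ Z
      simp at h1 hZ ⊢; omega
    have hr : Program.Runs (.comp .tail .head) (enc (a, ([] : List β), s)) .nil _ :=
      .comp (.tail _) (.head _)
    refine ⟨_, .loop_done hr, ?_⟩
    have h3 := Data.size_tail_le (enc (a, ([] : List β), s))
    simp only [List.length_nil, Polynomial.eval_add, Polynomial.eval_mul, Polynomial.eval_C,
      Polynomial.eval_X]
    nlinarith
  | cons b l ih =>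
    intro s hW Z hZ
    have h1 := hW [] (by simp)
    have h2 : (enc (a, b :: l, s)).size ≤ Z := by
      change esize (a, b :: l, s) ≤ Z
      simp at h1 hZ ⊢; omega
    obtain ⟨t, ht, ht'⟩ := ih (step a s b)
      (fun l' hl' => hW (b :: l') (by simpa using hl')) Z (by simp at hZ ⊢; omega)
    obtain ⟨u, hu, hu'⟩ := hP (a, (b, l), s)
    have hr : Program.Runs (.comp .tail .head) (enc (a, b :: l, s)) (.cons (enc b) (enc l)) _ :=
      .comp (.tail _) (.head _)
    refine ⟨_, .loop_step hr hu ht, ?_⟩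
    have h3 := Data.size_tail_le (enc (a, b :: l, s))
    have h4 : u ≤ p.eval Z := hu'.trans (p.eval_nat_mono h2)
    simp only [List.length_cons, Polynomial.eval_add, Polynomial.eval_mul, Polynomial.eval_C,
      Polynomial.eval_X] at *
    nlinarith

/-- A fold takes polynomial time if each step does and the sizes of the intermediate states are
polynomially bounded. The second condition does not follow from the first, since a step may double
the size of the state. -/
theorem foldl_of_prefix {l : α → List β} {init : α → σ} {step : α → σ → β → σ}
    (hstep : PolyTime (fun q : α × σ × β => step q.1 q.2.1 q.2.2))
    (hl : PolyTime l) (hinit : PolyTime init) (q : Polynomial ℕ)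
    (hq : ∀ a l', l' <+: l a → esize (l'.foldl (step a) (init a)) ≤ q.eval (esize a)) :
    PolyTime (fun a => (l a).foldl (step a) (init a)) := by
  obtain ⟨P, p, hP⟩ := exists_runs_fold hstep
  obtain ⟨r, hr⟩ := hl.esize_le
  have hloop : ∃ (P : Program) (p : Polynomial ℕ), ∀ a : α, ∃ t,
      P.Runs (enc a) (enc (a, ([] : List β), (l a).foldl (step a) (init a))) t ∧
        t ≤ p.eval (esize a) := by
    have h0 : PolyTime (fun a => (a, l a, init a)) := by fun_prop
    obtain ⟨Q, s, hQ⟩ := h0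
    refine ⟨.comp Q P, .X + s + r * p.comp (.X + r + q + .C 2), fun a => ?_⟩
    obtain ⟨t, ht, ht'⟩ := hQ a
    obtain ⟨u, hu, hu'⟩ := hP a (q.eval (esize a)) (l a) (init a) (hq a)
      (esize a + r.eval (esize a) + q.eval (esize a) + 2) (by have := hr a; omega)
    refine ⟨_, .comp ht hu, ?_⟩
    have h1 : (l a).length + 1 ≤ r.eval (esize a) := (length_lt_esize _).trans_le (hr a)
    have h2 := Nat.mul_le_mul_right
      (p.eval (esize a + r.eval (esize a) + q.eval (esize a) + 2)) h1
    simp only [Polynomial.eval_add, Polynomial.eval_mul, Polynomial.eval_C, Polynomial.eval_comp,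
      Polynomial.eval_X]
    simp only [esize] at *
    omega
  obtain ⟨Q, s, hQ⟩ := hloop
  have h : PolyTime (fun a => (a, ([] : List β), (l a).foldl (step a) (init a))) := ⟨Q, s, hQ⟩
  have h' : PolyTime (fun q : α × List β × σ => q.2.2) := by fun_prop
  exact h'.comp h

/-- A fold takes polynomial time if each step does and enlarges the state by an amount that is
bounded in terms of the context. -/
theorem foldl {l : α → List β} {init : α → σ} {step : α → σ → β → σ}
    (hstep : PolyTime (fun q : α × σ × β => step q.1 q.2.1 q.2.2))
    (hl : PolyTime l) (hinit : PolyTime init) (q : Polynomial ℕ)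
    (hq : ∀ a s, ∀ b ∈ l a, esize (step a s b) ≤ esize s + q.eval (esize a)) :
    PolyTime (fun a => (l a).foldl (step a) (init a)) := by
  obtain ⟨r, hr⟩ := hl.esize_le
  obtain ⟨i, hi⟩ := hinit.esize_le
  refine foldl_of_prefix hstep hl hinit (i + r * q) fun a l' hl' => ?_
  have key : ∀ (l' : List β) (s : σ), (∀ b ∈ l', b ∈ l a) →
      esize (l'.foldl (step a) s) ≤ esize s + l'.length * q.eval (esize a) := by
    intro l'
    induction l' with
    | nil => simp
    | cons b l' ih =>
      intro s h
      have h1 := ih (step a s b) (fun b hb => h b (by simp [hb]))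
      have h2 := hq a s b (h b (by simp))
      simp only [List.foldl_cons, List.length_cons, Nat.add_mul, one_mul]
      omega
  have h1 := key l' (init a) (fun b hb => hl'.subset hb)
  have h2 : l'.length ≤ r.eval (esize a) :=
    (hl'.length_le.trans (length_lt_esize _).le).trans (hr a)
  have h3 := Nat.mul_le_mul_right (q.eval (esize a)) h2
  have h4 := hi a
  simp only [Polynomial.eval_add, Polynomial.eval_mul]
  omega

/-! ### Lists, numbers and searches in polynomial time -/

@[fun_prop]
theorem list_reverse {f : α → List β} (hf : PolyTime f) : PolyTime (fun a => (f a).reverse) := by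
  obtain ⟨r, hr⟩ := hf.esize_le
  have := foldl (l := f) (init := fun _ => ([] : List β)) (step := fun _ s b => b :: s)
    (by fun_prop) hf (by fun_prop) (r + 1) (fun a s b hb => by
      have := esize_le_of_mem hb
      have := hr a
      simp; omega)
  simpa [List.foldl_flip_cons_eq_append'] using this

@[fun_prop]
theorem list_append {f g : α → List β} (hf : PolyTime f) (hg : PolyTime g) :
    PolyTime (fun a => f a ++ g a) := by
  obtain ⟨r, hr⟩ := (list_reverse hf).esize_le
  have := foldl (l := fun a => (f a).reverse) (init := g) (step := fun _ s b => b :: s)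
    (by fun_prop) (by fun_prop) hg (r + 1) (fun a s b hb => by
      have := esize_le_of_mem hb
      have := hr a
      simp; omega)
  simpa using this

/-- Polynomial bound on the values of `f` at the elements of a list. -/
theorem esize_le_of_mem_list {f : α → β → γ} {l : α → List β}
    (hf : PolyTime (fun q : α × β => f q.1 q.2)) (hl : PolyTime l) :
    ∃ p : Polynomial ℕ, ∀ a, ∀ b ∈ l a, esize (f a b) ≤ p.eval (esize a) := by
  obtain ⟨p, hp⟩ := hf.esize_le
  obtain ⟨r, hr⟩ := hl.esize_le
  refine ⟨p.comp (.X + r + 1), fun a b hb => (hp (a, b)).trans ?_⟩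
  simp only [Polynomial.eval_comp, Polynomial.eval_add, Polynomial.eval_X, Polynomial.eval_one]
  refine p.eval_nat_mono ?_
  have := esize_le_of_mem hb
  have := hr a
  simp; omega

@[fun_prop]
theorem list_flatMap {f : α → β → List γ} {l : α → List β}
    (hf : PolyTime (fun q : α × β => f q.1 q.2)) (hl : PolyTime l) :
    PolyTime (fun a => (l a).flatMap (f a)) := by
  obtain ⟨p, hp⟩ := esize_le_of_mem_list hf hl
  have hf' : PolyTime (fun q : α × List γ × β => f q.1 q.2.2) := by
    have h : PolyTime (fun q : α × List γ × β => (q.1, q.2.2)) := by fun_prop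
    exact hf.comp h
  have := foldl (l := l) (init := fun _ => ([] : List γ)) (step := fun a s b => s ++ f a b)
    (by fun_prop) hl (by fun_prop) p (fun a s b hb => by
      have := hp a b hb
      have := esize_append s (f a b)
      omega)
  have e : ∀ a, (l a).foldl (fun s b => s ++ f a b) [] = (l a).flatMap (f a) := by
    intro a
    rw [List.flatMap_eq_foldl]
  simpa only [e] using this

@[fun_prop]
theorem list_map {f : α → β → γ} {l : α → List β}
    (hf : PolyTime (fun q : α × β => f q.1 q.2)) (hl : PolyTime l) :
    PolyTime (fun a => (l a).map (f a)) := by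
  have : PolyTime (fun a => (l a).flatMap (fun b => [f a b])) := by fun_prop
  have e : ∀ a, (l a).flatMap (fun b => [f a b]) = (l a).map (f a) := by
    intro a
    induction l a <;> simp_all
  simpa only [e] using this

@[fun_prop]
theorem list_filter {f : α → β → Bool} {l : α → List β}
    (hf : PolyTime (fun q : α × β => f q.1 q.2)) (hl : PolyTime l) :
    PolyTime (fun a => (l a).filter (f a)) := by
  have : PolyTime (fun a => (l a).flatMap (fun b => bif f a b then [b] else [])) := by fun_prop
  have e : ∀ a, (l a).flatMap (fun b => bif f a b then [b] else []) = (l a).filter (f a) := by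
    intro a
    induction l a with
    | nil => rfl
    | cons b l ih => cases h : f a b <;> simp [ih, h]
  simpa only [e] using this

@[fun_prop]
theorem list_all {f : α → β → Bool} {l : α → List β}
    (hf : PolyTime (fun q : α × β => f q.1 q.2)) (hl : PolyTime l) :
    PolyTime (fun a => (l a).all (f a)) := by
  have : PolyTime (fun a => ((l a).filter (fun b => !f a b)).isEmpty) := by fun_prop
  have e : ∀ a, ((l a).filter (fun b => !f a b)).isEmpty = (l a).all (f a) := by
    intro a
    induction l a with
    | nil => rfl
    | cons b l ih => cases h : f a b <;> simp [ih, h]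
  simpa only [e] using this

@[fun_prop]
theorem list_any {f : α → β → Bool} {l : α → List β}
    (hf : PolyTime (fun q : α × β => f q.1 q.2)) (hl : PolyTime l) :
    PolyTime (fun a => (l a).any (f a)) := by
  have : PolyTime (fun a => !(l a).all (fun b => !f a b)) := by fun_prop
  have e : ∀ a, (!(l a).all (fun b => !f a b)) = (l a).any (f a) := by
    intro a
    induction l a <;> simp_all
  simpa only [e] using this

/-- Numbers are represented in unary. -/
theorem enc_nat (n : ℕ) : enc n = enc (List.replicate n ()) := by
  change encodeList _ _ = encodeList _ _
  generalize hl : List.range n = l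
  have : n = l.length := by simp [← hl]
  subst this
  clear hl
  induction l with
  | nil => rfl
  | cons a l ih => simp only [encodeList, List.length_cons, List.replicate_succ, ih]; rfl

@[simp] theorem esize_nat (n : ℕ) : esize n = 2 * n + 1 := by
  rw [esize, enc_nat]
  change esize (List.replicate n ()) = _
  induction n with
  | zero => rfl
  | succ n ih =>
    rw [List.replicate_succ, esize_cons, ih]
    change 1 + _ + 1 = _
    omega

theorem of_enc_eq {f : α → β} {g : α → γ} (hf : PolyTime f) (h : ∀ a, enc (f a) = enc (g a)) :
    PolyTime g := by
  obtain ⟨P, p, hP⟩ := hf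
  refine ⟨P, p, fun a => ?_⟩
  simpa only [h] using hP a

@[fun_prop]
theorem replicate_unit {f : α → ℕ} (hf : PolyTime f) :
    PolyTime (fun a => List.replicate (f a) ()) :=
  hf.of_enc_eq fun _ => enc_nat _

theorem of_replicate_unit {f : α → ℕ} (hf : PolyTime (fun a => List.replicate (f a) ())) :
    PolyTime f :=
  hf.of_enc_eq fun _ => (enc_nat _).symm

@[fun_prop]
theorem nat_succ {f : α → ℕ} (hf : PolyTime f) : PolyTime (fun a => f a + 1) := by
  apply of_replicate_unit
  simp only [List.replicate_succ]
  fun_prop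

@[fun_prop]
theorem nat_sub {f g : α → ℕ} (hf : PolyTime f) (hg : PolyTime g) :
    PolyTime (fun a => f a - g a) := by
  apply of_replicate_unit
  have := foldl (l := fun a => List.replicate (g a) ()) (init := fun a => List.replicate (f a) ())
    (step := fun _ s _ => s.tail) (by fun_prop) (by fun_prop) (by fun_prop) 0 (fun a s b hb => by
      cases s <;> simp; omega)
  have e : ∀ m n, (List.replicate m ()).foldl (fun s _ => s.tail) (List.replicate n ()) =
      List.replicate (n - m) () := by
    intro m
    induction m with
    | zero => simp
    | succ m ih =>
      intro n
      rw [List.replicate_succ, List.foldl_cons, List.tail_replicate, ih]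
      congr 1; omega
  simpa only [e] using this

@[fun_prop]
theorem nat_ble {f g : α → ℕ} (hf : PolyTime f) (hg : PolyTime g) :
    PolyTime (fun a => Nat.ble (f a) (g a)) := by
  have : PolyTime (fun a => (List.replicate (f a - g a) ()).isEmpty) := by fun_prop
  refine this.of_enc_eq fun a => congrArg enc ?_
  rw [Bool.eq_iff_iff]
  simp [Nat.sub_eq_zero_iff_le]

@[fun_prop]
theorem nat_beq {f g : α → ℕ} (hf : PolyTime f) (hg : PolyTime g) :
    PolyTime (fun a => f a == g a) := by
  have : PolyTime (fun a => Nat.ble (f a) (g a) && Nat.ble (g a) (f a)) := by fun_prop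
  refine this.of_enc_eq fun a => congrArg enc ?_
  rw [Bool.eq_iff_iff]
  simp; omega

@[fun_prop]
theorem list_getD {f : α → List β} {g : α → ℕ} (hf : PolyTime f) (hg : PolyTime g) (b : β) :
    PolyTime (fun a => (f a).getD (g a) b) := by
  have := foldl (l := fun a => List.replicate (g a) ()) (init := f)
    (step := fun _ s _ => s.tail) (by fun_prop) (by fun_prop) (by fun_prop) 0 (fun a s b hb => by
      cases s <;> simp; omega)
  have e : ∀ m (l : List β), ((List.replicate m ()).foldl (fun s _ => s.tail) l).headD b =
      l.getD m b := by
    intro m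
    induction m with
    | zero => intro l; cases l <;> simp
    | succ m ih =>
      intro l
      rw [List.replicate_succ, List.foldl_cons, ih]
      cases l <;> simp
  have := list_headD this b
  simpa only [e] using this

@[fun_prop]
theorem list_range {f : α → ℕ} (hf : PolyTime f) : PolyTime (fun a => List.range (f a)) := by
  have e : ∀ m, (List.replicate m ()).foldl
      (fun (s : ℕ × List ℕ) _ => (s.1 + 1, s.1 :: s.2)) (0, []) =
        (m, (List.range m).reverse) := by
    intro m
    induction m with
    | zero => rfl
    | succ m ih => rw [List.replicate_succ', List.foldl_concat, ih]; simp [List.range_succ]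
  have h : PolyTime (fun n : ℕ => (List.replicate n ()).foldl
      (fun (s : ℕ × List ℕ) _ => (s.1 + 1, s.1 :: s.2)) (0, [])) := by
    refine foldl_of_prefix (l := fun n : ℕ => List.replicate n ()) (init := fun _ => (0, []))
      (step := fun _ (s : ℕ × List ℕ) _ => (s.1 + 1, s.1 :: s.2)) (by fun_prop) (by fun_prop)
      (by fun_prop) (.X ^ 2 + .X + 4) fun n l' hl' => ?_
    obtain ⟨m, hm, rfl⟩ : ∃ m ≤ n, l' = List.replicate m () :=
      ⟨l'.length, by simpa using hl'.length_le, by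
        rw [List.eq_replicate_iff]; simp⟩
    rw [e]
    have h2 : ∀ m, esize (List.range m).reverse ≤ m * (2 * m + 2) + 1 := by
      intro m
      induction m with
      | zero => simp
      | succ m ih => simp [List.range_succ]; nlinarith
    have h3 := h2 m
    simp
    nlinarith
  simp only [e] at h
  have h' : PolyTime (fun n => List.range n) := by
    have h0 : PolyTime (fun q : ℕ × List ℕ => q.2.reverse) := by fun_prop
    have := h0.comp h
    simpa using this
  exact h'.comp hf

end PolyTime
end

/-! ### The algorithm -/

/-- The list of all sublists of the list of the first `c` entries. For a fixed number `c` it has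
bounded length. -/
def sublistsUpTo {α : Type} : ℕ → List α → List (List α)
  | 0, _ => [[]]
  | _ + 1, [] => [[]]
  | c + 1, a :: l => sublistsUpTo c l ++ (sublistsUpTo c l).map (a :: ·)

/-- Membership in a list of vertices. -/
def memB (X : List ℕ) (v : ℕ) : Bool := X.any fun u => u == v

/-- Starting from `X`, add `n` times the first vertex below `n` that is not yet in the list and is
admitted by `p`, if there is one. -/
def grow (n : ℕ) (p : List ℕ → ℕ → Bool) (X : List ℕ) : List ℕ :=
  (List.range n).foldl
    (fun X _ => (((List.range n).filter fun x => !memB X x && p X x).take 1) ++ X) X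

/-- The pairs `(u, v)` of vertices of a list with `u < v`. -/
def pairsOf (l : List ℕ) : List (ℕ × ℕ) :=
  l.flatMap fun u => (l.filter fun v => Nat.ble (u + 1) v).map fun v => (u, v)

/-- Adjacency in the graph given by a list of vertex pairs. -/
def hasE (es : List (ℕ × ℕ)) (u v : ℕ) : Bool :=
  es.any fun e => (e.1 == u && e.2 == v) || (e.1 == v && e.2 == u)

/-- The pairs of vertices below `n` that satisfy `f`. -/
def edgesOf (n : ℕ) (f : ℕ → ℕ → Bool) : List (ℕ × ℕ) :=
  (pairsOf (List.range n)).filter fun e => f e.1 e.2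

/-- The matrix of a binary predicate on the vertices below `n`. -/
def mat (n : ℕ) (f : ℕ → ℕ → Bool) : List (List Bool) :=
  (List.range n).map fun u => (List.range n).map fun v => f u v

/-- Whether the vertex set given by the bit vector `T` is connected in the graph `es`: its first
vertex reaches all the others. -/
def conG (n : ℕ) (es : List (ℕ × ℕ)) (T : List Bool) : Bool :=
  let X := grow n (fun X y => T.getD y false && X.any fun z => hasE es z y)
    (((List.range n).filter fun v => T.getD v false).take 1)
  !X.isEmpty && (List.range n).all fun v => !T.getD v false || memB X v

/-- Whether all degrees in the graph `es` are at most `d`. -/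
def degOK (d n : ℕ) (es : List (ℕ × ℕ)) : Bool :=
  (List.range n).all fun v => Nat.ble ((List.range n).filter fun u => hasE es v u).length d

/-- The number of vertices, the connected sets and the disconnected sets. -/
abbrev KSetsData : Type := ℕ × List (List Bool) × List (List Bool)

/-- Whether the vertex `x` completes a subset of `X` to a connected `k`-set. For connected `X` of
size at least `k - 1` not containing `x`, this says that `x` has a neighbour in `X`. -/
def touch (c : KSetsData) (X : List ℕ) (x : ℕ) : Bool :=
  c.2.1.any fun T => T.getD x false &&
    (List.range c.1).all fun v => v == x || (!T.getD v false || memB X v)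

/-- The root set: all vertices if there are fewer than `k`, and the first connected `k`-set
otherwise. -/
def root (k : ℕ) (c : KSetsData) : List ℕ :=
  bif Nat.ble k c.1 then (List.range c.1).filter fun v => (c.2.1.headD []).getD v false
  else List.range c.1

/-- Membership in the closed neighbourhood of the root set. -/
def near (k : ℕ) (c : KSetsData) (v : ℕ) : Bool := memB (root k c) v || touch c (root k c) v

/-- The vertices that are reached from the root set outside the closed neighbourhood of `w`. -/
def shadow (k : ℕ) (c : KSetsData) (w : ℕ) : List ℕ :=
  grow c.1 (fun X x => !(x == w) && (touch c X x && !touch c (x :: X) w)) (root k c)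

/-- Whether `u` is in or next to the part reached outside the closed neighbourhood of `w`. -/
def sepB (k : ℕ) (c : KSetsData) (w u : ℕ) : Bool :=
  memB (shadow k c w) u || touch c (shadow k c w) u

/-- Whether `u` and `w` are outside the closed neighbourhood of the root set and cannot be told
apart from it. -/
def clsB (k : ℕ) (c : KSetsData) (u w : ℕ) : Bool :=
  (!near k c u && !near k c w) && (!sepB k c w u && !sepB k c u w)

/-- Whether `u` has to be adjacent to `w`, since it is next to but not in the part reached outside
the closed neighbourhood of `w`. -/
def evB (k : ℕ) (c : KSetsData) (w u : ℕ) : Bool :=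
  !near k c w && (!memB (shadow k c w) u && touch c (shadow k c w) u)

/-- The known edges, given the edges `g` between vertices near the root set. -/
def knownB (k : ℕ) (c : KSetsData) (g : List (ℕ × ℕ)) (u v : ℕ) : Bool :=
  hasE g u v || (evB k c u v || evB k c v u)

/-- Whether `v` is in the part with index `r`: the class of `r` if `r` is its smallest element. -/
def partB (k : ℕ) (c : KSetsData) (r v : ℕ) : Bool :=
  clsB k c r v && (List.range r).all fun s => !clsB k c s v

/-- The known edges, the edges `C`, and all pairs in the other parts. -/
def fullG (k : ℕ) (c : KSetsData) (g : List (ℕ × ℕ)) (r : ℕ) (C : List (ℕ × ℕ)) : List (ℕ × ℕ) :=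
  edgesOf c.1 fun u v => knownB k c g u v || (hasE C u v || (clsB k c u v && !partB k c r u))

/-- The known edges and the edges `C`. -/
def emptyG (k : ℕ) (c : KSetsData) (g : List (ℕ × ℕ)) (C : List (ℕ × ℕ)) : List (ℕ × ℕ) :=
  edgesOf c.1 fun u v => knownB k c g u v || hasE C u v

/-- Whether `C` is in the collection of the part with index `r`: the connected sets are connected
when the other parts are complete, the disconnected sets are disconnected when the other parts are
empty, and then no degree exceeds `d`. -/
def okC (k d : ℕ) (c : KSetsData) (g : List (ℕ × ℕ)) (r : ℕ) (C : List (ℕ × ℕ)) : Bool :=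
  c.2.1.all (fun T => conG c.1 (fullG k c g r C) T) &&
    (c.2.2.all (fun T => !conG c.1 (emptyG k c g C) T) && degOK d c.1 (emptyG k c g C))

/-- The collection of the part with index `r`. -/
def collB (k d : ℕ) (c : KSetsData) (g : List (ℕ × ℕ)) (r : ℕ) : List (List (ℕ × ℕ)) :=
  (sublistsUpTo (d * d) (pairsOf ((List.range c.1).filter fun v => partB k c r v))).filter
    fun C => okC k d c g r C

/-- The completion formed from the first members of the collections. An empty collection
contributes no edges. -/
def starG (k d : ℕ) (c : KSetsData) (g : List (ℕ × ℕ)) : List (ℕ × ℕ) :=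
  edgesOf c.1 fun u v => knownB k c g u v ||
    (List.range c.1).any fun r => hasE ((collB k d c g r).headD []) u v

/-- Whether the graph `es` is connected, consistent and of maximum degree at most `d`. -/
def okG (d : ℕ) (c : KSetsData) (es : List (ℕ × ℕ)) : Bool :=
  (conG c.1 es ((List.range c.1).map fun _ => true) && degOK d c.1 es) &&
    (c.2.1.all (fun T => conG c.1 es T) && c.2.2.all (fun T => !conG c.1 es T))

/-- The output for one choice of the edges near the root set. -/
def outB (k d : ℕ) (c : KSetsData) (g : List (ℕ × ℕ)) :
    (List (List Bool) × List (List Bool) × List (List Bool)) ×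
      List (List Bool × List (List (List Bool))) :=
  ((mat c.1 fun u v => !(u == v) && knownB k c g u v,
    mat c.1 fun u v => !(u == v) && !(knownB k c g u v || clsB k c u v),
    mat c.1 fun u v => !(u == v) && clsB k c u v),
   (List.range c.1).map fun r => ((List.range c.1).map fun v => partB k c r v,
     (collB k d c g r).map fun C => mat c.1 fun u v => hasE C u v))

/-- The choices of edges near the root set that can be completed. At most `b` pairs are used. -/
def guesses (k d b : ℕ) (c : KSetsData) : List (List (ℕ × ℕ)) :=
  (sublistsUpTo b (pairsOf ((List.range c.1).filter fun v => near k c v))).filter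
    fun g => okG d c (starG k d c g)

theorem sublistsUpTo_nil {α : Type} (c : ℕ) : sublistsUpTo c ([] : List α) = [[]] := by
  cases c <;> rfl

theorem sublistsUpTo_succ {α : Type} (c : ℕ) (l : List α) :
    sublistsUpTo (c + 1) l = sublistsUpTo c l.tail ++
      (l.take 1).flatMap fun a => (sublistsUpTo c l.tail).map (a :: ·) := by
  cases l <;> simp [sublistsUpTo, sublistsUpTo_nil]

namespace PolyTime
section
variable {α β γ : Type} [Enc α] [Enc β] [Enc γ]

@[fun_prop]
theorem list_take_one {f : α → List β} (hf : PolyTime f) : PolyTime (fun a => (f a).take 1) := by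
  obtain ⟨r, hr⟩ := hf.esize_le
  have := foldl (l := f) (init := fun _ => ([] : List β))
    (step := fun _ s b => bif s.isEmpty then [b] else s)
    (by fun_prop) hf (by fun_prop) (r + 1) (fun a s b hb => by
      have := esize_le_of_mem hb
      have := hr a
      cases s <;> simp; omega)
  have e : ∀ l : List β, l.foldl (fun s b => bif s.isEmpty then [b] else s) [] = l.take 1 := by
    intro l
    cases l with
    | nil => rfl
    | cons b l =>
      simp only [List.foldl_cons, List.isEmpty_nil, cond_true, List.take_succ_cons, List.take_zero]
      induction l with
      | nil => rfl
      | cons c l ih => simpa using ih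
  simpa only [e] using this

@[fun_prop]
theorem sublistsUpTo (c : ℕ) {f : α → List β} (hf : PolyTime f) :
    PolyTime (fun a => sublistsUpTo c (f a)) := by
  suffices PolyTime (fun l : List β => _root_.sublistsUpTo c l) from this.comp hf
  induction c with
  | zero => simp only [_root_.sublistsUpTo]; fun_prop
  | succ c ih =>
    have ht : PolyTime (fun l : List β => _root_.sublistsUpTo c l.tail) := ih.comp (by fun_prop)
    simp only [sublistsUpTo_succ]
    fun_prop

@[fun_prop]
theorem list_length {f : α → List β} (hf : PolyTime f) : PolyTime (fun a => (f a).length) := by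
  apply of_replicate_unit
  have : PolyTime (fun a => (f a).map (fun _ => ())) := by fun_prop
  simpa [List.map_const'] using this

@[fun_prop]
theorem memB {f : α → List ℕ} {g : α → ℕ} (hf : PolyTime f) (hg : PolyTime g) :
    PolyTime (fun a => memB (f a) (g a)) := by
  unfold _root_.memB; fun_prop

@[fun_prop]
theorem grow {n : α → ℕ} {p : α → List ℕ → ℕ → Bool} {f : α → List ℕ} (hn : PolyTime n)
    (hp : PolyTime (fun q : α × List ℕ × ℕ => p q.1 q.2.1 q.2.2)) (hf : PolyTime f) :
    PolyTime (fun a => grow (n a) (p a) (f a)) := by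
  unfold _root_.grow
  obtain ⟨r, hr⟩ := hn.esize_le
  have hp' : PolyTime (fun q : (α × List ℕ × ℕ) × ℕ => p q.1.1 q.1.2.1 q.2) := by
    have h : PolyTime (fun q : (α × List ℕ × ℕ) × ℕ => (q.1.1, q.1.2.1, q.2)) := by fun_prop
    exact hp.comp h
  refine foldl (l := fun a => List.range (n a)) (init := f)
    (step := fun a X _ => (((List.range (n a)).filter fun x => !_root_.memB X x && p a X x).take 1)
      ++ X) (by fun_prop) (by fun_prop) hf (r + 1) fun a s b hb => ?_
  refine (esize_append _ _).trans ?_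
  have h := hr a
  rcases hl : (List.range (n a)).filter (fun x => !_root_.memB s x && p a s x) with _ | ⟨x, l⟩
  · simp; omega
  · have hx : x ∈ (List.range (n a)).filter (fun x => !_root_.memB s x && p a s x) := by simp [hl]
    have hx' : x < n a := by simpa using List.mem_of_mem_filter hx
    simp at h ⊢; omega

@[fun_prop]
theorem pairsOf {f : α → List ℕ} (hf : PolyTime f) : PolyTime (fun a => pairsOf (f a)) := by
  unfold _root_.pairsOf; fun_prop

@[fun_prop]
theorem hasE {f : α → List (ℕ × ℕ)} {g h : α → ℕ} (hf : PolyTime f) (hg : PolyTime g)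
    (hh : PolyTime h) : PolyTime (fun a => hasE (f a) (g a) (h a)) := by
  unfold _root_.hasE; fun_prop

@[fun_prop]
theorem edgesOf {n : α → ℕ} {f : α → ℕ → ℕ → Bool} (hn : PolyTime n)
    (hf : PolyTime (fun q : α × ℕ × ℕ => f q.1 q.2.1 q.2.2)) :
    PolyTime (fun a => edgesOf (n a) (f a)) := by
  unfold _root_.edgesOf; fun_prop

@[fun_prop]
theorem mat {n : α → ℕ} {f : α → ℕ → ℕ → Bool} (hn : PolyTime n)
    (hf : PolyTime (fun q : α × ℕ × ℕ => f q.1 q.2.1 q.2.2)) :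
    PolyTime (fun a => mat (n a) (f a)) := by
  have h : PolyTime (fun q : (α × ℕ) × ℕ => f q.1.1 q.1.2 q.2) := by
    have h : PolyTime (fun q : (α × ℕ) × ℕ => (q.1.1, q.1.2, q.2)) := by fun_prop
    exact hf.comp h
  unfold _root_.mat; fun_prop

@[fun_prop]
theorem conG {n : α → ℕ} {f : α → List (ℕ × ℕ)} {g : α → List Bool} (hn : PolyTime n)
    (hf : PolyTime f) (hg : PolyTime g) : PolyTime (fun a => conG (n a) (f a) (g a)) := by
  unfold _root_.conG; fun_prop

@[fun_prop]
theorem degOK (d : ℕ) {n : α → ℕ} {f : α → List (ℕ × ℕ)} (hn : PolyTime n) (hf : PolyTime f) :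
    PolyTime (fun a => degOK d (n a) (f a)) := by
  unfold _root_.degOK; fun_prop

variable {c : α → KSetsData} {X : α → List ℕ} {u v w : α → ℕ} {g C : α → List (ℕ × ℕ)}

@[fun_prop]
theorem touch (hc : PolyTime c) (hX : PolyTime X) (hv : PolyTime v) :
    PolyTime (fun a => touch (c a) (X a) (v a)) := by
  unfold _root_.touch; fun_prop

@[fun_prop]
theorem root (k : ℕ) (hc : PolyTime c) : PolyTime (fun a => root k (c a)) := by
  unfold _root_.root; fun_prop

@[fun_prop]
theorem near (k : ℕ) (hc : PolyTime c) (hv : PolyTime v) :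
    PolyTime (fun a => near k (c a) (v a)) := by
  unfold _root_.near; fun_prop

@[fun_prop]
theorem shadow (k : ℕ) (hc : PolyTime c) (hv : PolyTime v) :
    PolyTime (fun a => shadow k (c a) (v a)) := by
  unfold _root_.shadow; fun_prop

@[fun_prop]
theorem sepB (k : ℕ) (hc : PolyTime c) (hu : PolyTime u) (hv : PolyTime v) :
    PolyTime (fun a => sepB k (c a) (u a) (v a)) := by
  unfold _root_.sepB; fun_prop

@[fun_prop]
theorem clsB (k : ℕ) (hc : PolyTime c) (hu : PolyTime u) (hv : PolyTime v) :
    PolyTime (fun a => clsB k (c a) (u a) (v a)) := by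
  unfold _root_.clsB; fun_prop

@[fun_prop]
theorem evB (k : ℕ) (hc : PolyTime c) (hu : PolyTime u) (hv : PolyTime v) :
    PolyTime (fun a => evB k (c a) (u a) (v a)) := by
  unfold _root_.evB; fun_prop

@[fun_prop]
theorem knownB (k : ℕ) (hc : PolyTime c) (hg : PolyTime g) (hu : PolyTime u) (hv : PolyTime v) :
    PolyTime (fun a => knownB k (c a) (g a) (u a) (v a)) := by
  unfold _root_.knownB; fun_prop

@[fun_prop]
theorem partB (k : ℕ) (hc : PolyTime c) (hu : PolyTime u) (hv : PolyTime v) :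
    PolyTime (fun a => partB k (c a) (u a) (v a)) := by
  unfold _root_.partB; fun_prop

@[fun_prop]
theorem fullG (k : ℕ) (hc : PolyTime c) (hg : PolyTime g) (hu : PolyTime u) (hC : PolyTime C) :
    PolyTime (fun a => fullG k (c a) (g a) (u a) (C a)) := by
  unfold _root_.fullG; fun_prop

@[fun_prop]
theorem emptyG (k : ℕ) (hc : PolyTime c) (hg : PolyTime g) (hC : PolyTime C) :
    PolyTime (fun a => emptyG k (c a) (g a) (C a)) := by
  unfold _root_.emptyG; fun_prop

@[fun_prop]
theorem okC (k d : ℕ) (hc : PolyTime c) (hg : PolyTime g) (hu : PolyTime u) (hC : PolyTime C) :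
    PolyTime (fun a => okC k d (c a) (g a) (u a) (C a)) := by
  unfold _root_.okC; fun_prop

@[fun_prop]
theorem collB (k d : ℕ) (hc : PolyTime c) (hg : PolyTime g) (hu : PolyTime u) :
    PolyTime (fun a => collB k d (c a) (g a) (u a)) := by
  unfold _root_.collB; fun_prop

@[fun_prop]
theorem starG (k d : ℕ) (hc : PolyTime c) (hg : PolyTime g) :
    PolyTime (fun a => starG k d (c a) (g a)) := by
  unfold _root_.starG; fun_prop

@[fun_prop]
theorem okG (d : ℕ) (hc : PolyTime c) (hg : PolyTime g) :
    PolyTime (fun a => okG d (c a) (g a)) := by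
  unfold _root_.okG; fun_prop

@[fun_prop]
theorem outB (k d : ℕ) (hc : PolyTime c) (hg : PolyTime g) :
    PolyTime (fun a => outB k d (c a) (g a)) := by
  unfold _root_.outB; fun_prop

@[fun_prop]
theorem guesses (k d b : ℕ) (hc : PolyTime c) : PolyTime (fun a => guesses k d b (c a)) := by
  unfold _root_.guesses; fun_prop

theorem algorithm (k d b : ℕ) :
    PolyTime (fun c : KSetsData => (_root_.guesses k d b c).map (_root_.outB k d c)) := by
  fun_prop

end
end PolyTime

/-! ### Reachability and connected sets -/

section Graphs
variable {V : Type} {G G' : SimpleGraph V} {E Z A : Set V}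

/-- The vertices reached from `E` by walks of `G` all of whose later vertices are in `Z`. -/
inductive Reach (G : SimpleGraph V) (E Z : Set V) : V → Prop where
  | base {x : V} : x ∈ E → Reach G E Z x
  | step {x y : V} : Reach G E Z x → G.Adj x y → y ∈ Z → Reach G E Z y

theorem Reach.mono {E' Z' : Set V} {x : V} (h : Reach G E Z x)
    (hG : ∀ u v, G.Adj u v → G'.Adj u v) (hE : E ⊆ E') (hZ : Z ⊆ Z') : Reach G' E' Z' x := by
  induction h with
  | base h => exact Reach.base (hE h)
  | step _ h1 h2 ih => exact Reach.step ih (hG _ _ h1) (hZ h2)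

theorem Reach.mem {x : V} (h : Reach G E Z x) : x ∈ E ∨ x ∈ Z := by
  cases h with
  | base h => exact .inl h
  | step _ _ h => exact .inr h

/-- A walk that leaves `X` has a first edge leaving `X`. -/
theorem Reach.exists_crossing {X : Set V} {x : V} (h : Reach G E Z x) (hE : E ⊆ X) (hx : x ∉ X) :
    ∃ y ∈ X, ∃ z ∉ X, z ∈ Z ∧ G.Adj y z := by
  induction h with
  | base h => exact absurd (hE h) hx
  | @step x y _ h1 h2 ih =>
    by_cases hX : x ∈ X
    · exact ⟨x, hX, y, hx, h2, h1⟩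
    · exact ih hX

/-- The set `A` induces a connected subgraph of `G`. -/
def Cn (G : SimpleGraph V) (A : Set V) : Prop :=
  A.Nonempty ∧ ∀ a ∈ A, ∀ b ∈ A, Reach G {a} A b

theorem Cn.mono (h : Cn G A) (hG : ∀ u ∈ A, ∀ v ∈ A, G.Adj u v → G'.Adj u v) : Cn G' A := by
  refine ⟨h.1, fun a ha b hb => ?_⟩
  have := h.2 a ha b hb
  clear hb
  induction this with
  | base h => exact Reach.base h
  | @step x y h0 h1 h2 ih =>
    refine Reach.step ih (hG _ ?_ _ h2 h1) h2
    rcases h0.mem with h | h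
    · exact h ▸ ha
    · exact h

/-- A set meeting a connected set and closed in it contains it. -/
theorem Cn.subset_of_closed {X : Set V} (h : Cn G A) {a : V} (ha : a ∈ A) (haX : a ∈ X)
    (hX : ∀ x ∈ X, ∀ y ∈ A, x ∈ A → G.Adj x y → y ∈ X) : A ⊆ X := by
  intro b hb
  have := h.2 a ha b hb
  clear hb
  suffices b ∈ X ∧ b ∈ A from this.1
  induction this with
  | base h => rw [h]; exact ⟨haX, ha⟩
  | step _ h1 h2 ih => exact ⟨hX _ ih.1 _ h2 ih.2 h1, h2⟩

theorem Reach.trans {x y : V} (h : Reach G {x} Z y) (h' : Reach G E Z x) : Reach G E Z y := by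
  induction h with
  | base h => rw [h]; exact h'
  | step _ h1 h2 ih => exact Reach.step ih h1 h2

theorem Reach.symm {x y : V} (hx : x ∈ Z) (h : Reach G {x} Z y) : Reach G {y} Z x := by
  induction h with
  | base h => exact Reach.base h.symm
  | @step y z h0 h1 h2 ih =>
    refine ih.trans (Reach.step (Reach.base rfl) h1.symm ?_)
    rcases h0.mem with h | h
    · exact h ▸ hx
    · exact h

theorem cn_iff_exists : Cn G A ↔ ∃ a ∈ A, ∀ b ∈ A, Reach G {a} A b := by
  constructor
  · rintro ⟨⟨a, ha⟩, h⟩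
    exact ⟨a, ha, h a ha⟩
  · rintro ⟨a, ha, h⟩
    exact ⟨⟨a, ha⟩, fun b hb c hc => (h c hc).trans (Reach.symm ha (h b hb))⟩

/-- The component of `a` in the subgraph induced by `A`. -/
theorem cn_component {a : V} : Cn G {x | Reach G {a} A x} := by
  refine cn_iff_exists.2 ⟨a, Reach.base rfl, fun b hb => ?_⟩
  induction (hb : Reach G {a} A b) with
  | base h => exact Reach.base h
  | step h0 h1 h2 ih => exact Reach.step ih h1 (Reach.step h0 h1 h2)

theorem mem_component {a : V} : a ∈ {x | Reach G {a} A x} := Reach.base rfl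

theorem exists_not_mem_component (h : ¬ Cn G A) {a : V} (ha : a ∈ A) :
    ∃ b ∈ A, b ∉ {x | Reach G {a} A x} := by
  by_contra! hc
  exact h (cn_iff_exists.2 ⟨a, ha, hc⟩)

theorem Cn.exists_crossing {X : Set V} (h : Cn G A) {a b : V} (ha : a ∈ A) (haX : a ∈ X)
    (hb : b ∈ A) (hbX : b ∉ X) : ∃ y ∈ X ∩ A, ∃ z ∈ A, z ∉ X ∧ G.Adj y z := by
  by_contra! hc
  exact hbX (h.subset_of_closed ha haX
    (fun x hx y hy hxA hxy => by_contra fun hyX => hc x ⟨hx, hxA⟩ y hy hyX hxy) hb)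

theorem Cn.insert_adj {x y : V} (h : Cn G A) (hy : y ∈ A) (hxy : G.Adj y x) :
    Cn G (insert x A) := by
  refine cn_iff_exists.2 ⟨y, by simp [hy], fun b hb => ?_⟩
  rcases hb with rfl | hb
  · exact Reach.step (Reach.base rfl) hxy (by simp)
  · exact (h.2 y hy b hb).mono (fun _ _ h => h) le_rfl (Set.subset_insert _ _)

theorem cn_iff_connected : Cn G A ↔ (G.induce A).Connected := by
  constructor
  · rintro ⟨⟨a, ha⟩, h⟩
    rw [SimpleGraph.connected_iff_exists_forall_reachable]
    refine ⟨⟨a, ha⟩, fun ⟨b, hb⟩ => ?_⟩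
    have h1 := h a ha b hb
    have key : ∀ b, Reach G {a} A b → ∃ hb : b ∈ A, (G.induce A).Reachable ⟨a, ha⟩ ⟨b, hb⟩ := by
      intro b hb
      induction hb with
      | base h => cases h; exact ⟨ha, SimpleGraph.Reachable.refl _⟩
      | @step x y _ h1 h2 ih =>
        obtain ⟨hx, ih⟩ := ih
        refine ⟨h2, ih.trans (SimpleGraph.Adj.reachable ?_)⟩
        simpa using h1
    exact (key b h1).2
  · intro h
    obtain ⟨⟨a, ha⟩⟩ := h.nonempty
    refine cn_iff_exists.2 ⟨a, ha, fun b hb => ?_⟩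
    obtain ⟨p⟩ := h.preconnected ⟨a, ha⟩ ⟨b, hb⟩
    have key : ∀ x y : A, (G.induce A).Walk x y → Reach G {x.1} A y.1 := by
      intro x y p
      induction p with
      | nil => exact Reach.base rfl
      | @cons x y z h p ih =>
        refine ih.trans (Reach.step (Reach.base rfl) ?_ y.2)
        simpa using h
    exact key _ _ p

theorem cn_univ_iff : Cn G Set.univ ↔ G.Connected := by
  rw [cn_iff_connected]
  exact (SimpleGraph.induceUnivIso G).connected_iff

/-- In a connected set every vertex lies in connected subsets of all smaller sizes. -/
theorem Cn.exists_subset_card {A : Finset V} (h : Cn G (A : Set V)) {x : V} (hx : x ∈ A) {k : ℕ}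
    (hk : 1 ≤ k) (hkA : k ≤ A.card) : ∃ T ⊆ A, x ∈ T ∧ T.card = k ∧ Cn G (T : Set V) := by
  classical
  induction k, hk using Nat.le_induction with
  | base =>
    refine ⟨{x}, by simpa using hx, by simp, by simp, cn_iff_exists.2 ⟨x, by simp, fun b hb => ?_⟩⟩
    simp at hb
    exact Reach.base hb
  | succ k hk ih =>
    obtain ⟨T, hTA, hxT, hT, hc⟩ := ih (by omega)
    obtain ⟨b, hb, hbT⟩ : ∃ b ∈ A, b ∉ T := by
      by_contra! hcon
      have := Finset.card_le_card (show A ⊆ T from hcon)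
      omega
    obtain ⟨y, hy, z, hz, hzT, hyz⟩ :=
      h.exists_crossing (X := (T : Set V)) (Finset.mem_coe.2 hx) (Finset.mem_coe.2 hxT)
        (Finset.mem_coe.2 hb) (by simpa using hbT)
    refine ⟨insert z T, ?_, by simp [hxT], ?_, ?_⟩
    · exact Finset.insert_subset (by simpa using hz) hTA
    · rw [Finset.card_insert_of_notMem (by simpa using hzT), hT]
    · rw [Finset.coe_insert]
      exact hc.insert_adj hy.1 hyz

/-! ### Vertices that cannot be told apart from a root set -/

/-- The closed neighbourhood of the root set `E`. -/
def Near (G : SimpleGraph V) (E : Set V) (v : V) : Prop := v ∈ E ∨ ∃ e ∈ E, G.Adj e v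

/-- The vertices reached from the root set outside the closed neighbourhood of `w`. -/
def Shadow (G : SimpleGraph V) (E : Set V) (w : V) : Set V :=
  {x | Reach G E {y | y ≠ w ∧ ¬ G.Adj y w} x}

/-- `u` is in or next to the part reached from the root set outside the closed neighbourhood
of `w`. In other words, some connected set containing the root set contains or touches `u`, but
neither contains nor touches `w`. -/
def Separates (G : SimpleGraph V) (E : Set V) (w u : V) : Prop :=
  u ∈ Shadow G E w ∨ ∃ y ∈ Shadow G E w, G.Adj y u

/-- Away from the root set, `u` and `w` are touched by the same connected sets containing
the root set. -/
def Cls (G : SimpleGraph V) (E : Set V) (u w : V) : Prop :=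
  (¬ Near G E u ∧ ¬ Near G E w) ∧ ¬ Separates G E w u ∧ ¬ Separates G E u w

/-- `G'` is obtained from `G` by changing adjacencies inside classes only. -/
def IsVariant (G : SimpleGraph V) (E : Set V) (G' : SimpleGraph V) : Prop :=
  ∀ u v, ¬ Cls G E u v → (G'.Adj u v ↔ G.Adj u v)

/-- The part of `G` outside the classes. -/
def coreGraph (G : SimpleGraph V) (E : Set V) : SimpleGraph V where
  Adj u v := G.Adj u v ∧ ¬ Cls G E u v
  symm := ⟨fun _ _ h => ⟨h.1.symm, fun hc => h.2 ⟨hc.1.symm, hc.2.symm⟩⟩⟩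
  loopless := ⟨fun u h => G.loopless.irrefl u h.1⟩

variable {u v w x y : V}

theorem Cls.symm (h : Cls G E u w) : Cls G E w u := ⟨h.1.symm, h.2.symm⟩

theorem shadow_avoids (hw : ¬ Near G E w) (hy : y ∈ Shadow G E w) : y ≠ w ∧ ¬ G.Adj y w := by
  rcases Reach.mem hy with h | h
  · exact ⟨fun h' => hw (.inl (h' ▸ h)), fun h' => hw (.inr ⟨y, h, h'⟩)⟩
  · exact h

theorem not_sep_self (hw : ¬ Near G E w) : ¬ Separates G E w w := by
  rintro (h | ⟨y, h, h'⟩)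
  · exact (shadow_avoids hw h).1 rfl
  · exact (shadow_avoids hw h).2 h'

theorem Cls.refl (hw : ¬ Near G E w) : Cls G E w w :=
  ⟨⟨hw, hw⟩, not_sep_self hw, not_sep_self hw⟩

/-- If the shadow of `x` contains or touches `u`, it contains or touches the whole class of `u`:
otherwise it would be part of the shadow of some `u'` in the class, and that shadow neither
contains nor touches `u`. -/
theorem Separates.of_cls {u' : V} (h : Separates G E x u) (hu : Cls G E u u') :
    Separates G E x u' := by
  by_contra hc
  have hsub : Shadow G E x ⊆ Shadow G E u' := by
    intro y hy
    induction (hy : Reach G E _ y) with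
    | base h => exact Reach.base h
    | @step y z h0 h1 h2 ih =>
      have hz : z ∈ Shadow G E x := Reach.step h0 h1 h2
      exact Reach.step ih h1 ⟨fun e => hc (.inl (e ▸ hz)), fun e => hc (.inr ⟨z, hz, e⟩)⟩
  rcases h with h | ⟨y, h, h'⟩
  · exact hu.2.1 (.inl (hsub h))
  · exact hu.2.1 (.inr ⟨y, hsub h, h'⟩)

theorem Cls.trans (h : Cls G E u v) (h' : Cls G E v w) : Cls G E u w :=
  ⟨⟨h.1.1, h'.1.2⟩, fun hs => h'.2.1 (hs.of_cls h), fun hs => h.2.2 (hs.of_cls h'.symm)⟩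

theorem sep_or_sep (hu : ¬ Near G E u) (hw : ¬ Near G E w) (h : ¬ Cls G E u w) :
    Separates G E w u ∨ Separates G E u w := by
  by_contra! hc
  exact h ⟨⟨hu, hw⟩, hc⟩

theorem sep_of_near (hu : Near G E u) : Separates G E w u := by
  rcases hu with h | ⟨e, h, h'⟩
  · exact .inl (Reach.base h)
  · exact .inr ⟨e, Reach.base h, h'⟩

/-- `u` is next to but not in the part reached outside the closed neighbourhood of `w`. -/
def Evident (G : SimpleGraph V) (E : Set V) (w u : V) : Prop :=
  ¬ Near G E w ∧ u ∉ Shadow G E w ∧ ∃ y ∈ Shadow G E w, G.Adj y u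

theorem Evident.adj (h : Evident G E w u) : G.Adj u w := by
  obtain ⟨hw, hu, y, hy, hyu⟩ := h
  by_contra hc
  refine hu (Reach.step hy hyu ⟨?_, hc⟩)
  rintro rfl
  exact (shadow_avoids hw hy).2 hyu

theorem Separates.evident (hw : ¬ Near G E w) (h : Separates G E w u) (ha : G.Adj u w) :
    Evident G E w u := by
  have hu : u ∉ Shadow G E w := fun hu => (shadow_avoids hw hu).2 ha
  exact ⟨hw, hu, h.resolve_left hu⟩

/-- Outside the classes, the adjacencies are those near the root set and the evident ones. -/
theorem core_adj_iff : (coreGraph G E).Adj u v ↔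
    (Near G E u ∧ Near G E v ∧ G.Adj u v) ∨ Evident G E u v ∨ Evident G E v u := by
  constructor
  · rintro ⟨h, hc⟩
    by_cases hu : Near G E u <;> by_cases hv : Near G E v
    · exact .inl ⟨hu, hv, h⟩
    · exact .inr (.inr (Separates.evident hv (sep_of_near hu) h))
    · exact .inr (.inl (Separates.evident hu (sep_of_near hv) h.symm))
    · rcases sep_or_sep hu hv hc with hs | hs
      · exact .inr (.inr (hs.evident hv h))
      · exact .inr (.inl (hs.evident hu h.symm))
  · rintro (⟨hu, hv, h⟩ | h | h)
    · exact ⟨h, fun hc => hc.1.1 hu⟩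
    · exact ⟨h.adj.symm, fun hc => hc.2.2 (.inr h.2.2)⟩
    · exact ⟨h.adj, fun hc => hc.2.1 (.inr h.2.2)⟩

/-- If the root set reaches a vertex `a` inside `Z` along core edges, then what it reaches also
touches each vertex `b` of the class of `a` along a core edge: otherwise all of it would be in the
shadow of `b`. -/
theorem exists_core_adj {a b : V} (ha : Reach (coreGraph G E) E Z a) (hab : Cls G E a b) :
    ∃ y, Reach (coreGraph G E) E Z y ∧ (coreGraph G E).Adj y b := by
  by_contra! hc
  suffices ∀ x, Reach (coreGraph G E) E Z x → x ∈ Shadow G E b from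
    hab.2.1 (.inl (this a ha))
  intro x hx
  induction hx with
  | base h => exact Reach.base h
  | @step x y h0 h1 h2 ih =>
    refine Reach.step ih h1.1 ⟨?_, fun h => ?_⟩
    · rintro rfl
      exact hc _ h0 h1
    · have hcls : Cls G E y b := by
        by_contra hn
        exact hc y (Reach.step h0 h1 h2) ⟨h, hn⟩
      exact hcls.2.1 (.inr ⟨x, ih, h1.1⟩)

theorem IsVariant.core_le (h : IsVariant G E G') (huv : (coreGraph G E).Adj u v) : G'.Adj u v :=
  (h u v huv.2).2 huv.1

theorem isVariant_self : IsVariant G E G := fun _ _ _ => Iff.rfl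

/-- What the root set reaches inside `Z` along core edges is closed under the edges of all variants.
Hence reachability from the root set is the same in all variants. -/
theorem IsVariant.reach_step {a b : V} (h : IsVariant G E G')
    (ha : Reach (coreGraph G E) E Z a) (hab : G'.Adj a b) (hb : b ∈ Z) :
    Reach (coreGraph G E) E Z b := by
  by_cases hc : Cls G E a b
  · obtain ⟨y, hy, hyb⟩ := exists_core_adj ha hc
    exact Reach.step hy hyb hb
  · exact Reach.step ha ⟨(h a b hc).1 hab, hc⟩ hb

/-- If the root set tells the class of `w` from the class of `u`, then a connected set of
a variant that meets both classes contains or touches, along core edges, all vertices of the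
class of `w`. -/
theorem exists_core_adj_of_sep (hG' : IsVariant G E G') (hA : Cn G' A) {u' w' w'' : V}
    (hs : Separates G E w u) (hu : Cls G E u u') (hu' : u' ∈ A) (hw : Cls G E w w') (hw' : w' ∈ A)
    (hww : Cls G E w w'') : ∃ y ∈ A, (coreGraph G E).Adj y w'' := by
  have h1 : ∀ x ∈ Shadow G E w, Reach (coreGraph G E) E (Shadow G E w ∪ A) x := by
    intro x hx
    induction hx with
    | base h => exact Reach.base h
    | step h0 h1 h2 ih =>
      exact isVariant_self.reach_step ih h1 (.inl (Reach.step h0 h1 h2))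
  have h2 : Reach (coreGraph G E) E (Shadow G E w ∪ A) u' := by
    rcases hs.of_cls hu with h | ⟨y, h, h'⟩
    · exact h1 _ h
    · exact isVariant_self.reach_step (h1 _ h) h' (.inr hu')
  have h3 := hA.subset_of_closed (X := {x | Reach (coreGraph G E) E (Shadow G E w ∪ A) x}) hu' h2
    (fun x hx y hy _ hxy => hG'.reach_step hx hxy (.inr hy)) hw'
  obtain ⟨y, hy, hyw⟩ := exists_core_adj h3 (hw.symm.trans hww)
  have hn : y ∉ Shadow G E w := fun h => hww.2.2 (.inr ⟨y, h, hyw.1⟩)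
  refine ⟨y, ?_, hyw⟩
  rcases hy.mem with h | h
  · exact absurd (Reach.base h) hn
  · exact h.resolve_left hn

/-- A set is connected in a variant if it remains connected whenever all classes but one are
completed. -/
theorem IsVariant.cn_of_forall (hG' : IsVariant G E G') {S : Set V} {F : V → SimpleGraph V}
    (hF : ∀ r u v, (F r).Adj u v → G'.Adj u v ∨ (Cls G E u v ∧ ¬ Cls G E r u))
    [Nonempty V] (h : ∀ r, Cn (F r) S) : Cn G' S := by
  by_contra hn
  obtain ⟨a, ha⟩ := (h (Classical.arbitrary V)).1
  obtain ⟨b, hb, hbA⟩ := exists_not_mem_component hn ha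
  set A := {x | Reach G' {a} S x}
  have haA : a ∈ A := Reach.base rfl
  have hA : Cn G' A := cn_component
  have hclosed : ∀ y ∈ A, ∀ z ∈ S, z ∉ A → ¬ G'.Adj y z :=
    fun y hy z hz hzA hyz => hzA (Reach.step hy hyz hz)
  have cross : ∀ r, ∃ y ∈ A, ∃ z ∈ S, z ∉ A ∧ Cls G E y z ∧ ¬ Cls G E r y := by
    intro r
    obtain ⟨y, hy, z, hz, hzA, hyz⟩ := (h r).exists_crossing ha haA hb hbA
    exact ⟨y, hy.1, z, hz, hzA, (hF r y z hyz).resolve_left (hclosed y hy.1 z hz hzA)⟩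
  obtain ⟨u₁, hu₁, w₁, hw₁, hw₁A, h₁, -⟩ := cross a
  obtain ⟨u₂, hu₂, w₂, hw₂, hw₂A, h₂, h₁₂⟩ := cross u₁
  rcases sep_or_sep h₁.1.1 h₂.1.1 h₁₂ with hs | hs
  · obtain ⟨y, hy, hyw⟩ := exists_core_adj_of_sep hG' hA hs (Cls.refl h₁.1.1) hu₁
      (Cls.refl h₂.1.1) hu₂ h₂
    exact hclosed y hy _ hw₂ hw₂A (hG'.core_le hyw)
  · obtain ⟨y, hy, hyw⟩ := exists_core_adj_of_sep hG' hA hs (Cls.refl h₂.1.1) hu₂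
      (Cls.refl h₁.1.1) hu₁ h₁
    exact hclosed y hy _ hw₁ hw₁A (hG'.core_le hyw)

/-- The variant `G'` restricted, inside the classes, to the classes of the members of `J`. -/
def onlyClasses (G : SimpleGraph V) (E : Set V) (G' : SimpleGraph V) (J : Set V) :
    SimpleGraph V where
  Adj u v := G'.Adj u v ∧ (Cls G E u v → ∃ r ∈ J, Cls G E r u)
  symm := ⟨fun u v h => ⟨h.1.symm, fun hc => by
    obtain ⟨r, hr, hru⟩ := h.2 hc.symm
    exact ⟨r, hr, hru.trans hc.symm⟩⟩⟩
  loopless := ⟨fun u h => G'.loopless.irrefl u h.1⟩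

theorem IsVariant.restrict (h : IsVariant G E G') (J : Set V) :
    IsVariant G E (onlyClasses G E G' J) := by
  intro u v huv
  rw [← h u v huv]
  exact ⟨fun h => h.1, fun h => ⟨h, fun hc => absurd hc huv⟩⟩

/-- A set is disconnected in a variant if it is disconnected whenever all classes but one are
emptied: the classes are filled in one after the other, and no class can be the first to connect
the set. -/
theorem IsVariant.not_cn_of_forall [Finite V] (hG' : IsVariant G E G') {S : Set V}
    (h : ∀ r, ¬ Cn (onlyClasses G E G' {r}) S) : ¬ Cn G' S := by
  classical
  have := Fintype.ofFinite V
  -- add the classes one by one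
  suffices key : ∀ J : Finset V, ¬ Cn (onlyClasses G E G' J) S by
    intro hc
    refine key Finset.univ (hc.mono fun u _ v _ huv => ⟨huv, fun hc => ⟨u, by simp, ?_⟩⟩)
    exact Cls.refl hc.1.1
  intro J
  induction J using Finset.induction_on with
  | empty =>
    intro hc
    obtain ⟨a, ha⟩ := hc.1
    refine h a (hc.mono fun u _ v _ huv => ⟨huv.1, fun hc => ?_⟩)
    simpa using huv.2 hc
  | insert r J _ ih =>
    intro hc
    -- the variants with the class of `r` only, with the classes of `J`, and with both
    set G₀ := onlyClasses G E G' {r} with hG₀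
    set G₁ := onlyClasses G E G' J with hG₁
    set G₂ := onlyClasses G E G' ↑(insert r J) with hG₂
    have hv₀ : IsVariant G E G₀ := hG'.restrict _
    have hv₁ : IsVariant G E G₁ := hG'.restrict _
    have h₂₁ : ∀ p q, G₂.Adj p q → ¬ G₁.Adj p q → Cls G E p q ∧ Cls G E r p := by
      intro p q h2 h1
      have hpq : Cls G E p q := by
        by_contra hn
        exact h1 ⟨h2.1, fun hc => absurd hc hn⟩
      refine ⟨hpq, ?_⟩
      obtain ⟨s, hs, hsp⟩ := h2.2 hpq
      rcases Finset.mem_insert.1 (Finset.mem_coe.1 hs) with rfl | hs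
      · exact hsp
      · exact absurd ⟨h2.1, fun _ => ⟨s, hs, hsp⟩⟩ h1
    have h₂₀ : ∀ p q, G₂.Adj p q → ¬ G₀.Adj p q → Cls G E p q ∧ ¬ Cls G E r p := by
      intro p q h2 h1
      have hpq : Cls G E p q := by
        by_contra hn
        exact h1 ⟨h2.1, fun hc => absurd hc hn⟩
      exact ⟨hpq, fun hrp => h1 ⟨h2.1, fun _ => ⟨r, rfl, hrp⟩⟩⟩
    obtain ⟨s, hs⟩ := hc.1
    -- a vertex of `S` in the class of `r`
    obtain ⟨x, hx, hrx⟩ : ∃ x ∈ S, Cls G E r x := by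
      obtain ⟨b, hb, hbA⟩ := exists_not_mem_component ih hs
      obtain ⟨y, hy, z, hz, hzA, hyz⟩ := hc.exists_crossing hs mem_component hb hbA
      exact ⟨y, hy.2, (h₂₁ y z hyz fun h1 => hzA (Reach.step hy.1 h1 hz)).2⟩
    -- an edge leaving its component in `G₀`
    obtain ⟨b, hb, hbA⟩ := exists_not_mem_component (h r) hx
    obtain ⟨y, hy, z, hz, hzA, hyz⟩ := hc.exists_crossing hx mem_component hb hbA
    obtain ⟨hyzc, hry⟩ := h₂₀ y z hyz fun h1 => hzA (Reach.step hy.1 h1 hz)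
    rcases sep_or_sep hrx.1.1 hyzc.1.1 hry with hsep | hsep
    · obtain ⟨q, hq, hqz⟩ := exists_core_adj_of_sep hv₀ cn_component hsep hrx
        mem_component (Cls.refl hyzc.1.1) hy.1 hyzc
      exact hzA (Reach.step hq (hv₀.core_le hqz) hz)
    · obtain ⟨b, hb, hbP⟩ := exists_not_mem_component ih hy.2
      obtain ⟨p, hp, q, hq, hqP, hpq⟩ := hc.exists_crossing hy.2 mem_component hb hbP
      obtain ⟨hpqc, hrp⟩ := h₂₁ p q hpq fun h1 => hqP (Reach.step hp.1 h1 hq)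
      obtain ⟨q', hq', hqq⟩ := exists_core_adj_of_sep hv₁ cn_component hsep
        (Cls.refl hyzc.1.1) mem_component hrp hp.1 (hrp.trans hpqc)
      exact hqP (Reach.step hq' (hv₁.core_le hqq) hq)

/-- All vertices of a class have a common neighbour: the vertex through which a set growing from
the root set first touches the class. -/
theorem exists_common_neighbor (hG : G.Connected) (hE : E.Nonempty) (hu : ¬ Near G E u) :
    ∃ z, ∀ u', Cls G E u u' → G.Adj z u' := by
  obtain ⟨e, he⟩ := hE
  set Z : Set V := {y | ∀ u', Cls G E u u' → y ≠ u' ∧ ¬ G.Adj y u'} with hZ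
  have hX : ∀ y, Reach G E Z y → y ∈ Z := by
    intro y hy
    rcases hy.mem with h | h
    · intro u' hu'
      exact ⟨fun e => hu'.1.2 (.inl (e ▸ h)), fun e => hu'.1.2 (.inr ⟨y, h, e⟩)⟩
    · exact h
  have hr : Reach G {e} Set.univ u := (cn_univ_iff.2 hG).2 e trivial u trivial
  obtain ⟨y, hy, z, hz, -, hyz⟩ := hr.exists_crossing (X := {y | Reach G E Z y})
    (by rintro _ rfl; exact Reach.base he) fun h => (hX u h u (Cls.refl hu)).1 rfl
  have hzU : ∀ u', Cls G E u u' → z ≠ u' := by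
    rintro u' hu' rfl
    exact (hX y hy z hu').2 hyz
  have hzZ : z ∉ Z := fun h => hz (Reach.step hy hyz h)
  simp only [hZ, Set.mem_ofPred_eq, not_forall] at hzZ
  obtain ⟨u', hu', h'⟩ := hzZ
  have hzu' : G.Adj z u' := by
    by_contra hn
    exact h' ⟨hzU u' hu', hn⟩
  refine ⟨z, fun u'' hu'' => ?_⟩
  by_contra hn
  have hy' : y ∈ Shadow G E u'' :=
    (hy : Reach G E Z y).mono (fun _ _ h => h) le_rfl fun x hx => hx u'' hu''
  exact (hu'.symm.trans hu'').2.1 (.inr ⟨z, Reach.step hy' hyz ⟨hzU u'' hu'', hn⟩, hzu'⟩)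

/-- The root set reaches all vertices along edges outside the classes. -/
theorem IsVariant.connected (hG' : IsVariant G E G') (hG : G.Connected) (hE : Cn G E) :
    G'.Connected := by
  obtain ⟨e, he⟩ := hE.1
  have hE' : Cn G' E := hE.mono fun u hu v _ huv =>
    (hG' u v fun hc => hc.1.1 (.inl hu)).2 huv
  refine cn_univ_iff.1 (cn_iff_exists.2 ⟨e, trivial, fun b _ => ?_⟩)
  have h1 : Reach (coreGraph G E) E Set.univ b := by
    have := (cn_univ_iff.2 hG).2 e trivial b trivial
    induction this with
    | base h => rw [h]; exact Reach.base he
    | step _ h1 h2 ih => exact isVariant_self.reach_step (ih trivial) h1 h2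
  induction h1 with
  | base h => exact (hE'.2 e he _ h).mono (fun _ _ h => h) le_rfl (Set.subset_univ _)
  | step _ h1 h2 ih => exact Reach.step (ih trivial) (hG'.core_le h1) h2

end Graphs

/-! ### Correctness of the list operations -/

theorem sublist_of_mem_sublistsUpTo {α : Type} {c : ℕ} {l s : List α}
    (h : s ∈ sublistsUpTo c l) : s.Sublist l := by
  induction c generalizing l s with
  | zero => simp [sublistsUpTo] at h; simp [h]
  | succ c ih =>
    cases l with
    | nil => simp [sublistsUpTo] at h; simp [h]
    | cons a l =>
      simp only [sublistsUpTo, List.mem_append, List.mem_map] at h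
      rcases h with h | ⟨t, h, rfl⟩
      · exact (ih h).cons a
      · exact (ih h).cons_cons a

theorem mem_sublistsUpTo {α : Type} {c : ℕ} {l s : List α} (h : s.Sublist l)
    (hl : l.length ≤ c) : s ∈ sublistsUpTo c l := by
  induction c generalizing l s with
  | zero =>
    obtain rfl : l = [] := by simpa using hl
    simpa [sublistsUpTo] using h
  | succ c ih =>
    cases h with
    | slnil => simp [sublistsUpTo]
    | cons a h => exact List.mem_append_left _ (ih h (by simpa using hl))
    | cons_cons a h =>
      exact List.mem_append_right _ (List.mem_map_of_mem (ih h (by simpa using hl)))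

theorem length_sublistsUpTo_le {α : Type} (c : ℕ) (l : List α) :
    (sublistsUpTo c l).length ≤ 2 ^ c := by
  induction c generalizing l with
  | zero => simp [sublistsUpTo]
  | succ c ih =>
    cases l with
    | nil => simp [sublistsUpTo, Nat.one_le_two_pow]
    | cons a l =>
      have := ih l
      simp only [sublistsUpTo, List.length_append, List.length_map, pow_succ]
      omega

theorem memB_iff {X : List ℕ} {v : ℕ} : memB X v = true ↔ v ∈ X := by
  simp [memB]

theorem memB_eq_false {X : List ℕ} {v : ℕ} : memB X v = false ↔ v ∉ X := by
  rw [← memB_iff, Bool.not_eq_true]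

/-- What holds of `X` and is kept by adding admissible vertices holds of the result of `grow`. -/
theorem grow_induction {n : ℕ} {p : List ℕ → ℕ → Bool} {X : List ℕ} {inv : List ℕ → Prop}
    (h0 : inv X) (hs : ∀ X x, inv X → x < n → x ∉ X → p X x = true → inv (x :: X)) :
    inv (grow n p X) := by
  unfold grow
  rw [List.foldl_const]
  generalize (List.range n).length = m
  induction m with
  | zero => exact h0
  | succ m ih =>
    rw [Function.iterate_succ_apply']
    generalize Nat.iterate _ m X = Y at ih ⊢
    rcases hl : (List.range n).filter (fun x => !memB Y x && p Y x) with _ | ⟨x, l⟩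
    · exact ih
    · have hx : x ∈ (List.range n).filter (fun x => !memB Y x && p Y x) := by
        rw [hl]; exact List.mem_cons_self
      simp only [List.mem_filter, List.mem_range, Bool.and_eq_true, Bool.not_eq_true',
        memB_eq_false] at hx
      exact hs Y x ih hx.1 hx.2.1 hx.2.2

/-- No admissible vertex is left outside the result of `grow`. -/
theorem grow_closed {n : ℕ} {p : List ℕ → ℕ → Bool} {X : List ℕ} (hX : X ≠ []) (hnd : X.Nodup)
    (hlt : ∀ x ∈ X, x < n) {x : ℕ} (hx : x < n) (hxg : x ∉ grow n p X) :
    p (grow n p X) x = false := by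
  have hinv : (grow n p X).Nodup ∧ ∀ x ∈ grow n p X, x < n := by
    refine grow_induction (inv := fun X => X.Nodup ∧ ∀ x ∈ X, x < n) ⟨hnd, hlt⟩ ?_
    rintro X x ⟨h1, h2⟩ hx hxX -
    exact ⟨List.nodup_cons.2 ⟨hxX, h1⟩, by simpa [hx] using h2⟩
  set g : List ℕ → List ℕ := fun X =>
    (((List.range n).filter fun x => !memB X x && p X x).take 1) ++ X with hg
  have key : ∀ m, (∀ x < n, x ∉ g^[m] X → p (g^[m] X) x = false) ∨ m + 1 ≤ (g^[m] X).length := by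
    intro m
    induction m with
    | zero => exact .inr (List.length_pos_iff.2 hX)
    | succ m ih =>
      rw [Function.iterate_succ_apply']
      set Y := g^[m] X
      rcases hl : (List.range n).filter (fun x => !memB Y x && p Y x) with _ | ⟨y, l⟩
      · have hY : g Y = Y := by simp [hg, hl]
        rw [hY]
        left
        intro x hx hxY
        rw [List.filter_eq_nil_iff] at hl
        have := hl x (by simpa using hx)
        simpa [memB_eq_false.2 hxY] using this
      · have hY : g Y = y :: Y := by simp [hg, hl]
        have hy : y ∈ (List.range n).filter (fun x => !memB Y x && p Y x) := by simp [hl]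
        simp only [List.mem_filter, List.mem_range, Bool.and_eq_true, Bool.not_eq_true',
          memB_eq_false] at hy
        rcases ih with ih | ih
        · simp [ih y hy.1 hy.2.1] at hy
        · right; rw [hY]; simpa using ih
  have e : grow n p X = g^[n] X := by
    unfold grow
    rw [List.foldl_const, List.length_range]
  rw [e] at hinv hxg ⊢
  rcases key n with h | h
  · exact h x hx hxg
  · have h1 : g^[n] X ⊆ List.range n := fun x hx => by simpa using hinv.2 x hx
    have h2 := (hinv.1.subperm h1).length_le
    simp at h2
    omega

theorem mem_pairsOf {l : List ℕ} {e : ℕ × ℕ} :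
    e ∈ pairsOf l ↔ e.1 ∈ l ∧ e.2 ∈ l ∧ e.1 < e.2 := by
  obtain ⟨u, v⟩ := e
  simp only [pairsOf, List.mem_flatMap, List.mem_map, List.mem_filter, Nat.ble_eq, Prod.mk.injEq]
  constructor
  · rintro ⟨a, ha, b, ⟨hb, hab⟩, rfl, rfl⟩
    exact ⟨ha, hb, hab⟩
  · rintro ⟨h1, h2, h3⟩
    exact ⟨u, h1, v, ⟨h2, h3⟩, rfl, rfl⟩

theorem length_pairsOf_le (l : List ℕ) : (pairsOf l).length ≤ l.length * l.length := by
  unfold pairsOf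
  rw [List.length_flatMap]
  refine (List.sum_le_card_nsmul _ l.length ?_).trans (by simp)
  simp only [List.mem_map]
  rintro _ ⟨u, -, rfl⟩
  simpa using List.length_filter_le _ l

theorem hasE_iff {es : List (ℕ × ℕ)} {u v : ℕ} :
    hasE es u v = true ↔ (u, v) ∈ es ∨ (v, u) ∈ es := by
  simp only [hasE, List.any_eq_true, Bool.or_eq_true, Bool.and_eq_true, beq_iff_eq]
  constructor
  · rintro ⟨⟨a, b⟩, h, ⟨rfl, rfl⟩ | ⟨rfl, rfl⟩⟩
    · exact .inl h
    · exact .inr h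
  · rintro (h | h)
    · exact ⟨_, h, .inl ⟨rfl, rfl⟩⟩
    · exact ⟨_, h, .inr ⟨rfl, rfl⟩⟩

theorem hasE_comm {es : List (ℕ × ℕ)} {u v : ℕ} : hasE es u v = hasE es v u := by
  rw [Bool.eq_iff_iff, hasE_iff, hasE_iff, or_comm]

/-- Edges chosen among the pairs of a list join distinct members of the list. -/
theorem mem_of_hasE {l : List ℕ} {es : List (ℕ × ℕ)} (hes : es.Sublist (pairsOf l)) {u v : ℕ}
    (h : hasE es u v = true) : u ∈ l ∧ v ∈ l ∧ u ≠ v := by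
  rcases hasE_iff.1 h with h | h
  · obtain ⟨h1, h2, h3⟩ := mem_pairsOf.1 (hes.subset h)
    exact ⟨h1, h2, h3.ne⟩
  · obtain ⟨h1, h2, h3⟩ := mem_pairsOf.1 (hes.subset h)
    exact ⟨h2, h1, h3.ne'⟩

theorem hasE_filter_pairsOf {l : List ℕ} {f : ℕ → ℕ → Bool} {u v : ℕ}
    (hf : f u v = f v u) :
    hasE ((pairsOf l).filter fun e => f e.1 e.2) u v = true ↔
      u ∈ l ∧ v ∈ l ∧ u ≠ v ∧ f u v = true := by
  simp only [hasE_iff, List.mem_filter, mem_pairsOf]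
  rw [← hf]
  constructor
  · rintro (⟨⟨h1, h2, h3⟩, h4⟩ | ⟨⟨h1, h2, h3⟩, h4⟩)
    · exact ⟨h1, h2, h3.ne, h4⟩
    · exact ⟨h2, h1, h3.ne', h4⟩
  · rintro ⟨h1, h2, h3, h4⟩
    rcases lt_or_gt_of_ne h3 with h | h
    · exact .inl ⟨⟨h1, h2, h⟩, h4⟩
    · exact .inr ⟨⟨h2, h1, h⟩, h4⟩

section
variable {n : ℕ}

/-- The graph on `Fin n` given by a list of vertex pairs. -/
def graphOf (n : ℕ) (es : List (ℕ × ℕ)) : SimpleGraph (Fin n) where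
  Adj u v := u ≠ v ∧ hasE es u v = true
  symm := ⟨fun _ _ h => ⟨h.1.symm, by rw [hasE_comm]; exact h.2⟩⟩
  loopless := ⟨fun _ h => h.1 rfl⟩

theorem graphOf_edgesOf_adj {f : ℕ → ℕ → Bool} {u v : Fin n} (hf : f u v = f v u) :
    (graphOf n (edgesOf n f)).Adj u v ↔ u ≠ v ∧ f u v = true := by
  simp only [graphOf, edgesOf, hasE_filter_pairsOf hf, List.mem_range, u.2, v.2, true_and,
    ne_eq, Fin.val_inj]
  tauto

/-- A vertex set as a list of bits. -/
def bits (S : Finset (Fin n)) : List Bool := (List.finRange n).map fun v => decide (v ∈ S)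

theorem bits_getD (S : Finset (Fin n)) (v : Fin n) :
    (bits S).getD v false = decide (v ∈ S) := by
  simp [bits, List.getD_eq_getElem?_getD]

theorem bits_univ : bits (Finset.univ : Finset (Fin n)) = (List.range n).map fun _ => true := by
  simp [bits, List.map_const']

theorem range_all_iff {f : ℕ → Bool} :
    (List.range n).all f = true ↔ ∀ v : Fin n, f v = true := by
  simp only [List.all_eq_true, List.mem_range]
  exact ⟨fun h v => h v v.2, fun h v hv => h ⟨v, hv⟩⟩

theorem range_any_iff {f : ℕ → Bool} :
    (List.range n).any f = true ↔ ∃ v : Fin n, f v = true := by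
  simp only [List.any_eq_true, List.mem_range]
  exact ⟨fun ⟨v, hv, h⟩ => ⟨⟨v, hv⟩, h⟩, fun ⟨v, h⟩ => ⟨v, v.2, h⟩⟩

theorem length_filter_range (f : ℕ → Bool) :
    ((List.range n).filter f).length = (Finset.univ.filter fun v : Fin n => f v = true).card := by
  rw [← List.map_coe_finRange_eq_range, List.filter_map, List.length_map]
  have : (Finset.univ.filter fun v : Fin n => f v = true) =
      ((List.finRange n).filter (f ∘ fun v : Fin n => (v : ℕ))).toFinset := by
    ext v; simp
  rw [this, List.toFinset_card_of_nodup ((List.nodup_finRange n).filter _)]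

theorem conG_iff {es : List (ℕ × ℕ)} {S : Finset (Fin n)} :
    conG n es (bits S) = true ↔ Cn (graphOf n es) (S : Set (Fin n)) := by
  unfold conG
  set p : List ℕ → ℕ → Bool := fun X y => (bits S).getD y false && X.any fun z => hasE es z y
    with hp
  rcases hl : (List.range n).filter (fun v => (bits S).getD v false) with _ | ⟨a, l⟩
  · have hS : S = ∅ := by
      rw [List.filter_eq_nil_iff] at hl
      ext v
      have := hl v (by simp)
      rw [bits_getD] at this
      simpa using this
    have h0 : grow n p [] = [] :=
      grow_induction (inv := fun X => X = []) rfl (by rintro _ x rfl - - h; simp [hp] at h)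
    subst hS
    simp [Cn, h0]
  · have ha : a ∈ (List.range n).filter (fun v => (bits S).getD v false) := by
      rw [hl]; exact List.mem_cons_self
    rw [List.mem_filter, List.mem_range] at ha
    obtain ⟨han, haS⟩ := ha
    lift a to Fin n using han
    rw [bits_getD, decide_eq_true_eq] at haS
    simp only [List.take_succ_cons, List.take_zero, Bool.and_eq_true, range_all_iff,
      Bool.or_eq_true, Bool.not_eq_true', memB_iff, bits_getD, decide_eq_false_iff_not]
    have h1 : (a : ℕ) ∈ grow n p [(a : ℕ)] ∧
        ∀ v ∈ grow n p [(a : ℕ)], ∃ h : v < n, Reach (graphOf n es) {a} S ⟨v, h⟩ := by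
      refine grow_induction (inv := fun X => (a : ℕ) ∈ X ∧ ∀ v ∈ X, ∃ h : v < n,
        Reach (graphOf n es) {a} S ⟨v, h⟩) ?_ ?_
      · refine ⟨by simp, fun v hv => ?_⟩
        obtain rfl : v = a := by simpa using hv
        exact ⟨a.2, .base rfl⟩
      · rintro X x ⟨haX, hX⟩ hx hxX hpx
        refine ⟨List.mem_cons_of_mem _ haX, fun v hv => ?_⟩
        rcases List.mem_cons.1 hv with rfl | hv
        · have hb := bits_getD S ⟨v, hx⟩
          simp only at hb
          simp only [hp, hb, Bool.and_eq_true, decide_eq_true_eq, List.any_eq_true] at hpx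
          obtain ⟨hvS, z, hz, hzv⟩ := hpx
          obtain ⟨hzn, hr⟩ := hX z hz
          refine ⟨hx, hr.step ⟨fun e => hxX ?_, hzv⟩ hvS⟩
          rw [← show z = v from congrArg Fin.val e]
          exact hz
        · exact hX v hv
    have h2 : ∀ v, Reach (graphOf n es) {a} S v → (v : ℕ) ∈ grow n p [(a : ℕ)] := by
      intro v hv
      induction hv with
      | base h => rw [h]; exact h1.1
      | @step x y _ hxy hy ih =>
        by_contra hc
        have := grow_closed (by simp) (by simp) (by simp) y.2 hc
        simp only [hp, bits_getD, Bool.and_eq_false_iff, decide_eq_false_iff_not,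
          List.any_eq_false] at this
        rcases this with h | h
        · exact h hy
        · exact h _ ih hxy.2
    constructor
    · rintro ⟨-, h⟩
      exact cn_iff_exists.2 ⟨a, haS, fun b hb => (h1.2 b ((h b).resolve_left (not_not.2 hb))).2⟩
    · intro h
      refine ⟨?_, fun b => or_iff_not_imp_left.2 fun hb => h2 b (h.2 a haS b (not_not.1 hb))⟩
      rw [List.isEmpty_eq_false_iff]
      exact List.ne_nil_of_mem h1.1

/-- All degrees of `G` are at most `d`. -/
def DegLe {V : Type} (d : ℕ) (G : SimpleGraph V) : Prop :=
  ∀ (v : V) (s : Finset V), (∀ u ∈ s, G.Adj v u) → s.card ≤ d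

theorem degLe_iff_maxDegree {V : Type} [Fintype V] {d : ℕ} {G : SimpleGraph V}
    [DecidableRel G.Adj] : G.maxDegree ≤ d ↔ DegLe d G := by
  constructor
  · intro h v s hs
    refine le_trans ?_ ((G.degree_le_maxDegree v).trans h)
    exact Finset.card_le_card fun u hu => by simpa using hs u hu
  · intro h
    exact G.maxDegree_le_of_forall_degree_le d fun v =>
      h v (G.neighborFinset v) fun u hu => by simpa using hu

theorem DegLe.mono {V : Type} {d : ℕ} {G G' : SimpleGraph V} (h : DegLe d G)
    (hG : ∀ u v, G'.Adj u v → G.Adj u v) : DegLe d G' :=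
  fun v s hs => h v s fun u hu => hG _ _ (hs u hu)

theorem degOK_iff {d : ℕ} {f : ℕ → ℕ → Bool} :
    degOK d n (edgesOf n f) = true ↔ DegLe d (graphOf n (edgesOf n f)) := by
  have hloop : ∀ v u : Fin n, hasE (edgesOf n f) v u = true ↔
      (graphOf n (edgesOf n f)).Adj v u := by
    intro v u
    refine ⟨fun h => ⟨fun e => ?_, h⟩, fun h => h.2⟩
    exact (mem_of_hasE List.filter_sublist h).2.2 (congrArg _ e)
  simp only [degOK, range_all_iff, Nat.ble_eq, length_filter_range, hloop]
  constructor
  · intro h v s hs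
    exact (Finset.card_le_card fun u hu => by simpa [hloop] using hs u hu).trans (h v)
  · intro h v
    exact h v _ fun u hu => by simpa [hloop] using hu

end

/-! ### What the algorithm computes from the sets of a graph -/

section
variable {n k : ℕ} {l₁ l₂ : List (Finset (Fin n))} {G : SimpleGraph (Fin n)}

/-- The data given by lists of connected and disconnected sets. -/
def dataOf (l₁ l₂ : List (Finset (Fin n))) : KSetsData := (n, l₁.map bits, l₂.map bits)

/-- `G` is connected and `l₁` lists its connected `k`-sets. -/
def IsModel (k : ℕ) (l₁ : List (Finset (Fin n))) (G : SimpleGraph (Fin n)) : Prop :=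
  G.Connected ∧ ∀ S, S ∈ l₁ ↔ S.card = k ∧ Cn G (S : Set (Fin n))

/-- The root set as a set of elements of `Fin n`. -/
def rootSet (k : ℕ) (l₁ l₂ : List (Finset (Fin n))) : Set (Fin n) :=
  {v | (v : ℕ) ∈ root k (dataOf l₁ l₂)}

theorem touch_iff {X : List ℕ} {x : Fin n} : touch (dataOf l₁ l₂) X x = true ↔
    ∃ S ∈ l₁, x ∈ S ∧ ∀ v ∈ S, v = x ∨ (v : ℕ) ∈ X := by
  simp only [touch, dataOf, List.any_eq_true, List.mem_map, Bool.and_eq_true]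
  constructor
  · rintro ⟨_, ⟨S, hS, rfl⟩, hx, h⟩
    rw [range_all_iff] at h
    simp only [bits_getD, decide_eq_true_eq] at hx
    refine ⟨S, hS, hx, fun v hv => ?_⟩
    simpa [-List.getD_eq_getElem?_getD, bits_getD, hv, memB_iff, Fin.val_inj] using h v
  · rintro ⟨S, hS, hx, h⟩
    refine ⟨_, ⟨S, hS, rfl⟩, by simpa only [bits_getD, decide_eq_true_eq] using hx, ?_⟩
    rw [range_all_iff]
    intro v
    by_cases hv : v ∈ S
    · simpa [-List.getD_eq_getElem?_getD, bits_getD, hv, memB_iff, Fin.val_inj] using h v hv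
    · simp [-List.getD_eq_getElem?_getD, bits_getD, hv]

/-- For a connected set with at least `k` elements, the `k`-sets tell which vertices it touches. -/
theorem touch_iff_adj (hk : 2 ≤ k) (hG : IsModel k l₁ G) {X : List ℕ}
    (hX : Cn G {v : Fin n | (v : ℕ) ∈ X}) {E : Finset (Fin n)} (hE : E.card = k)
    (hEX : ∀ v ∈ E, (v : ℕ) ∈ X) {x : Fin n} (hx : (x : ℕ) ∉ X) :
    touch (dataOf l₁ l₂) X x = true ↔ ∃ y : Fin n, (y : ℕ) ∈ X ∧ G.Adj y x := by
  classical
  rw [touch_iff]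
  constructor
  · rintro ⟨S, hS, hxS, h⟩
    obtain ⟨hSk, hSc⟩ := (hG.2 S).1 hS
    obtain ⟨b, hb, hbx⟩ := Finset.exists_mem_ne (by omega : 1 < S.card) x
    obtain ⟨y, hy, z, hz, hzx, hyz⟩ := hSc.exists_crossing (X := {x}) (Finset.mem_coe.2 hxS) rfl
      (Finset.mem_coe.2 hb) hbx
    obtain rfl : y = x := hy.1
    exact ⟨z, (h z (Finset.mem_coe.1 hz)).resolve_left hzx, hyz.symm⟩
  · rintro ⟨y, hy, hyx⟩
    have hc := hX.insert_adj hy hyx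
    have e : insert x {v : Fin n | (v : ℕ) ∈ X} =
        ((Finset.univ.filter fun v : Fin n => v = x ∨ (v : ℕ) ∈ X : Finset (Fin n)) :
          Set (Fin n)) := by
      ext v; simp
    rw [e] at hc
    obtain ⟨T, hT, hxT, hTk, hTc⟩ := hc.exists_subset_card (x := x) (by simp)
      (by omega : 1 ≤ k) (by
        rw [← hE]
        exact Finset.card_le_card fun v hv => by simp [hEX v hv])
    exact ⟨T, (hG.2 T).2 ⟨hTk, hTc⟩, hxT, fun v hv => by simpa using hT hv⟩

theorem root_nodup : (root k (dataOf l₁ l₂)).Nodup := by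
  unfold root
  cases Nat.ble k _
  · exact List.nodup_range
  · exact List.nodup_range.filter _

theorem lt_of_mem_root {x : ℕ} (hx : x ∈ root k (dataOf l₁ l₂)) : x < n := by
  unfold root at hx
  cases h : Nat.ble k (dataOf l₁ l₂).1 <;> rw [h] at hx
  · simpa [dataOf] using hx
  · simpa [dataOf] using List.mem_of_mem_filter hx

/-- The root set consists of all vertices if there are fewer than `k`, and is a connected `k`-set
otherwise. -/
theorem rootSet_cases (hk : 2 ≤ k) (hG : IsModel k l₁ G) :
    (n < k ∧ rootSet k l₁ l₂ = Set.univ) ∨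
      ∃ S : Finset (Fin n), S.card = k ∧ Cn G (S : Set (Fin n)) ∧ rootSet k l₁ l₂ = S := by
  rcases lt_or_ge n k with h | h
  · refine .inl ⟨h, ?_⟩
    have hb : Nat.ble k n = false := by
      rw [← Bool.not_eq_true, Nat.ble_eq]; omega
    ext v
    simp [rootSet, root, dataOf, hb]
  · right
    obtain ⟨v⟩ := hG.1.nonempty
    have hc := cn_univ_iff.2 hG.1
    rw [← Finset.coe_univ] at hc
    obtain ⟨T, -, -, hTk, hTc⟩ := hc.exists_subset_card (Finset.mem_univ v) (by omega : 1 ≤ k)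
      (by simpa using h)
    have hT := (hG.2 T).2 ⟨hTk, hTc⟩
    obtain ⟨S, l, rfl⟩ := List.exists_cons_of_ne_nil (List.ne_nil_of_mem hT)
    obtain ⟨hSk, hSc⟩ := (hG.2 S).1 List.mem_cons_self
    refine ⟨S, hSk, hSc, ?_⟩
    have hb : Nat.ble k n = true := by rwa [Nat.ble_eq]
    ext v
    simp [-List.getD_eq_getElem?_getD, rootSet, root, dataOf, hb, bits_getD]

theorem cn_rootSet (hk : 2 ≤ k) (hG : IsModel k l₁ G) : Cn G (rootSet k l₁ l₂) := by
  rcases rootSet_cases (l₂ := l₂) hk hG with ⟨-, h⟩ | ⟨S, -, hS, h⟩ <;> rw [h]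
  · exact cn_univ_iff.2 hG.1
  · exact hS

theorem exists_card_of_notMem_rootSet (hk : 2 ≤ k) (hG : IsModel k l₁ G) {w : Fin n}
    (hw : w ∉ rootSet k l₁ l₂) :
    ∃ S : Finset (Fin n), S.card = k ∧ rootSet k l₁ l₂ = S := by
  rcases rootSet_cases (l₂ := l₂) hk hG with ⟨-, h⟩ | ⟨S, hS, -, h⟩
  · exact absurd (by rw [h]; trivial) hw
  · exact ⟨S, hS, h⟩

theorem near_iff (hk : 2 ≤ k) (hG : IsModel k l₁ G) {v : Fin n} :
    near k (dataOf l₁ l₂) v = true ↔ Near G (rootSet k l₁ l₂) v := by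
  rw [near, Bool.or_eq_true, memB_iff]
  by_cases hv : (v : ℕ) ∈ root k (dataOf l₁ l₂)
  · exact ⟨fun _ => .inl hv, fun _ => .inl hv⟩
  · obtain ⟨S, hS, e⟩ := exists_card_of_notMem_rootSet hk hG hv
    rw [touch_iff_adj hk hG (cn_rootSet hk hG) hS (fun v hv => ?_) hv]
    · rfl
    · have : v ∈ rootSet k l₁ l₂ := by rw [e]; exact hv
      exact this

/-- The computed shadow is the shadow in every model, and it is a connected set large enough for
`touch_iff_adj` to apply to it. -/
theorem shadow_spec (hk : 2 ≤ k) (hG : IsModel k l₁ G) {w : Fin n}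
    (hw : ¬ Near G (rootSet k l₁ l₂) w) :
    (∃ S : Finset (Fin n), S.card = k ∧ ∀ v ∈ S, (v : ℕ) ∈ shadow k (dataOf l₁ l₂) w) ∧
    Cn G {v : Fin n | (v : ℕ) ∈ shadow k (dataOf l₁ l₂) w} ∧
    ∀ v : Fin n, (v : ℕ) ∈ shadow k (dataOf l₁ l₂) w ↔ v ∈ Shadow G (rootSet k l₁ l₂) w := by
  set c := dataOf l₁ l₂ with hc
  set E := rootSet k l₁ l₂ with hE
  obtain ⟨S, hS, e⟩ := exists_card_of_notMem_rootSet hk hG fun h => hw (.inl h)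
  have hSroot : ∀ v ∈ S, (v : ℕ) ∈ root k c := fun v hv => by
    have : v ∈ rootSet k l₁ l₂ := by rw [e]; exact hv
    exact this
  set p : List ℕ → ℕ → Bool := fun X x => !(x == w) && (touch c X x && !touch c (x :: X) w)
    with hp
  -- what the tests say about a set that has been grown
  have htest : ∀ X : List ℕ, Cn G {v : Fin n | (v : ℕ) ∈ X} → (∀ v ∈ root k c, v ∈ X) →
      (∀ v : Fin n, (v : ℕ) ∈ X → v ∈ Shadow G E w) → ∀ x : Fin n, (x : ℕ) ∉ X →
      (p X x = true ↔ (∃ y : Fin n, (y : ℕ) ∈ X ∧ G.Adj y x) ∧ x ≠ w ∧ ¬ G.Adj x w) := by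
    intro X hX hroot hsh x hx
    simp only [hp, Bool.and_eq_true, Bool.not_eq_true', beq_eq_false_iff_ne, ne_eq, Fin.val_inj]
    have ht := touch_iff_adj (l₂ := l₂) hk hG hX hS (fun v hv => hroot v (hSroot v hv)) hx
    rw [← hc] at ht
    rw [ht]
    by_cases hxw : x = w
    · simp [hxw]
    by_cases hy : ∃ y : Fin n, (y : ℕ) ∈ X ∧ G.Adj y x
    · obtain ⟨y, hy, hyx⟩ := hy
      have hX' : Cn G {v : Fin n | (v : ℕ) ∈ (x : ℕ) :: X} := by
        have := hX.insert_adj hy hyx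
        convert this using 1
        ext v
        simp [Fin.val_inj]
      have hwX : (w : ℕ) ∉ (x : ℕ) :: X := by
        simp only [List.mem_cons, not_or, Fin.val_inj]
        exact ⟨fun h => hxw h.symm, fun h => (shadow_avoids hw (hsh w h)).1 rfl⟩
      have ht' := touch_iff_adj (l₂ := l₂) hk hG hX' hS
        (fun v hv => List.mem_cons_of_mem _ (hroot v (hSroot v hv))) hwX
      rw [← hc] at ht'
      rw [← Bool.not_eq_true, ht']
      have hex : (∃ y : Fin n, (y : ℕ) ∈ (x : ℕ) :: X ∧ G.Adj y w) ↔ G.Adj x w := by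
        constructor
        · rintro ⟨z, hz, hzw⟩
          rcases List.mem_cons.1 hz with h | h
          · rwa [← Fin.ext h]
          · exact absurd hzw (shadow_avoids hw (hsh z h)).2
        · exact fun h => ⟨x, List.mem_cons_self, h⟩
      rw [hex]
      have : ∃ y : Fin n, (y : ℕ) ∈ X ∧ G.Adj y x := ⟨y, hy, hyx⟩
      tauto
    · simp only [hy, false_and, and_false]
  have hinv : (∀ v ∈ root k c, v ∈ shadow k c w) ∧
      Cn G {v : Fin n | (v : ℕ) ∈ shadow k c w} ∧
      ∀ v : Fin n, (v : ℕ) ∈ shadow k c w → v ∈ Shadow G E w := by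
    refine grow_induction (inv := fun X => (∀ v ∈ root k c, v ∈ X) ∧
      Cn G {v : Fin n | (v : ℕ) ∈ X} ∧ ∀ v : Fin n, (v : ℕ) ∈ X → v ∈ Shadow G E w)
      ⟨fun v hv => hv, cn_rootSet hk hG, fun v hv => .base hv⟩ ?_
    rintro X x ⟨hroot, hX, hsh⟩ (hx : x < n) hxX hpx
    lift x to Fin n using hx
    obtain ⟨⟨y, hy, hyx⟩, hxw, hnxw⟩ := (htest X hX hroot hsh x hxX).1 hpx
    refine ⟨fun v hv => List.mem_cons_of_mem _ (hroot v hv), ?_, fun v hv => ?_⟩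
    · have := hX.insert_adj hy hyx
      convert this using 1
      ext v
      simp [Fin.val_inj]
    · rcases List.mem_cons.1 hv with h | h
      · rw [Fin.ext h]
        exact Reach.step (hsh y hy) hyx ⟨hxw, hnxw⟩
      · exact hsh v h
  obtain ⟨hroot, hX, hsh⟩ := hinv
  refine ⟨⟨S, hS, fun v hv => hroot v (hSroot v hv)⟩, hX, fun v => ⟨hsh v, fun hv => ?_⟩⟩
  induction (hv : Reach G E _ v) with
  | base h => exact hroot _ h
  | @step y x _ hyx hx ih =>
    by_contra hcon
    have hne : root k c ≠ [] := by
      obtain ⟨a, ha⟩ := (cn_rootSet (l₂ := l₂) hk hG).1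
      exact List.ne_nil_of_mem ha
    have h := grow_closed (p := p) hne root_nodup (fun x hx => lt_of_mem_root hx) x.2 hcon
    have h' := (htest _ hX hroot hsh x hcon).2 ⟨⟨y, ih, hyx⟩, hx⟩
    exact Bool.false_ne_true (h.symm.trans h')

theorem sepB_iff (hk : 2 ≤ k) (hG : IsModel k l₁ G) {w u : Fin n}
    (hw : ¬ Near G (rootSet k l₁ l₂) w) :
    sepB k (dataOf l₁ l₂) w u = true ↔ Separates G (rootSet k l₁ l₂) w u := by
  obtain ⟨⟨S, hS, hSX⟩, hX, hsh⟩ := shadow_spec hk hG hw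
  rw [sepB, Bool.or_eq_true, memB_iff]
  by_cases hu : (u : ℕ) ∈ shadow k (dataOf l₁ l₂) w
  · exact ⟨fun _ => .inl ((hsh u).1 hu), fun _ => .inl hu⟩
  · rw [touch_iff_adj hk hG hX hS hSX hu]
    simp only [hsh, Separates]

theorem evB_iff (hk : 2 ≤ k) (hG : IsModel k l₁ G) {w u : Fin n} :
    evB k (dataOf l₁ l₂) w u = true ↔ Evident G (rootSet k l₁ l₂) w u := by
  rw [evB, Evident, Bool.and_eq_true, Bool.not_eq_true', ← Bool.not_eq_true, near_iff hk hG]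
  refine and_congr_right fun hw => ?_
  obtain ⟨⟨S, hS, hSX⟩, hX, hsh⟩ := shadow_spec hk hG hw
  rw [Bool.and_eq_true, Bool.not_eq_true', memB_eq_false, ← hsh]
  refine and_congr_right fun hu => ?_
  rw [touch_iff_adj hk hG hX hS hSX hu]
  simp only [hsh]

theorem clsB_iff (hk : 2 ≤ k) (hG : IsModel k l₁ G) {u w : Fin n} :
    clsB k (dataOf l₁ l₂) u w = true ↔ Cls G (rootSet k l₁ l₂) u w := by
  rw [clsB, Cls, Bool.and_eq_true, Bool.and_eq_true]
  simp only [Bool.not_eq_true', ← Bool.not_eq_true (near _ _ _), near_iff hk hG]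
  refine and_congr_right fun h => ?_
  rw [Bool.and_eq_true]
  simp only [Bool.not_eq_true', ← Bool.not_eq_true (sepB _ _ _ _), sepB_iff hk hG h.1,
    sepB_iff hk hG h.2]

/-- `v` is in the part with index `r`, which is the class of `r` if `r` is its smallest element and
empty otherwise. -/
def InPart (G : SimpleGraph (Fin n)) (E : Set (Fin n)) (r v : Fin n) : Prop :=
  Cls G E r v ∧ ∀ s < r, ¬ Cls G E s v

theorem partB_iff (hk : 2 ≤ k) (hG : IsModel k l₁ G) {r v : Fin n} :
    partB k (dataOf l₁ l₂) r v = true ↔ InPart G (rootSet k l₁ l₂) r v := by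
  rw [partB, InPart, Bool.and_eq_true, clsB_iff hk hG, range_all_iff]
  refine and_congr_right fun _ => ?_
  simp only [Bool.not_eq_true', ← Bool.not_eq_true (clsB _ _ _ _)]
  constructor
  · intro h s hs
    rw [← clsB_iff hk hG]
    exact h ⟨s, hs⟩
  · intro h s
    have := h ⟨s, s.2.trans r.2⟩ s.2
    rwa [← clsB_iff hk hG] at this

section InPart
variable {E : Set (Fin n)} {r s u v : Fin n}

theorem InPart.of_cls (h : InPart G E r u) (huv : Cls G E u v) : InPart G E r v :=
  ⟨h.1.trans huv, fun s hs hsv => h.2 s hs (hsv.trans huv.symm)⟩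

theorem InPart.cls (h : InPart G E r u) (h' : InPart G E r v) : Cls G E u v :=
  h.1.symm.trans h'.1

theorem InPart.index_eq (h : InPart G E r u) (h' : InPart G E s u) : r = s := by
  rcases lt_trichotomy r s with hlt | rfl | hlt
  · exact absurd h.1 (h'.2 r hlt)
  · rfl
  · exact absurd h'.1 (h.2 s hlt)

theorem exists_inPart (hu : ¬ Near G E u) : ∃ r, InPart G E r u := by
  classical
  obtain ⟨r, hr, hmin⟩ := (Finset.univ.filter fun r => Cls G E r u).exists_minimal
    ⟨u, by simpa using Cls.refl hu⟩
  simp only [Finset.mem_filter, Finset.mem_univ, true_and] at hr hmin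
  exact ⟨r, hr, fun s hs hsu => absurd (hmin hsu hs.le) (not_le.2 hs)⟩

end InPart
end

/-! ### The skeletons -/

section
variable {n k d : ℕ} {l₁ l₂ : List (Finset (Fin n))} {G G' : SimpleGraph (Fin n)}
  {g : List (ℕ × ℕ)}

/-- `G` is a connected graph of maximum degree at most `d` that is consistent with the lists of
connected and disconnected sets. -/
def Good (d : ℕ) (l₁ l₂ : List (Finset (Fin n))) (G : SimpleGraph (Fin n)) : Prop :=
  (G.Connected ∧ DegLe d G) ∧ (∀ S ∈ l₁, Cn G (S : Set (Fin n))) ∧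
    ∀ S ∈ l₂, ¬ Cn G (S : Set (Fin n))

theorem Good.isModel (h : Good d l₁ l₂ G) (hl : ∀ S, S ∈ l₁ ∨ S ∈ l₂ ↔ S.card = k) :
    IsModel k l₁ G := by
  refine ⟨h.1.1, fun S => ⟨fun hS => ⟨(hl S).1 (.inl hS), h.2.1 S hS⟩, fun hS => ?_⟩⟩
  exact ((hl S).2 hS.1).resolve_right fun h' => h.2.2 S h' hS.2

/-- `g` lists the edges of `G` near the root set `E`. -/
def IsGuess (G : SimpleGraph (Fin n)) (E : Set (Fin n)) (g : List (ℕ × ℕ)) : Prop :=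
  ∀ u v : Fin n, hasE g u v = true ↔ Near G E u ∧ Near G E v ∧ G.Adj u v

theorem knownB_iff (hk : 2 ≤ k) (hG : IsModel k l₁ G) (hg : IsGuess G (rootSet k l₁ l₂) g)
    {u v : Fin n} : knownB k (dataOf l₁ l₂) g u v = true ↔
      (coreGraph G (rootSet k l₁ l₂)).Adj u v := by
  rw [knownB, Bool.or_eq_true, Bool.or_eq_true, evB_iff hk hG, evB_iff hk hG, hg, core_adj_iff]

theorem knownB_comm {c : KSetsData} {u v : ℕ} : knownB k c g u v = knownB k c g v u := by
  rw [knownB, knownB, hasE_comm, Bool.or_comm (evB k c u v)]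

theorem emptyG_adj (hk : 2 ≤ k) (hG : IsModel k l₁ G) (hg : IsGuess G (rootSet k l₁ l₂) g)
    {C : List (ℕ × ℕ)} {u v : Fin n} : (graphOf n (emptyG k (dataOf l₁ l₂) g C)).Adj u v ↔
      u ≠ v ∧ ((coreGraph G (rootSet k l₁ l₂)).Adj u v ∨ hasE C u v = true) := by
  unfold emptyG
  rw [dataOf, graphOf_edgesOf_adj (by rw [knownB_comm, hasE_comm]), Bool.or_eq_true, ← dataOf,
    knownB_iff hk hG hg]

theorem fullG_adj (hk : 2 ≤ k) (hG : IsModel k l₁ G) (hg : IsGuess G (rootSet k l₁ l₂) g)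
    {r : Fin n} {C : List (ℕ × ℕ)} {u v : Fin n} :
    (graphOf n (fullG k (dataOf l₁ l₂) g r C)).Adj u v ↔
      u ≠ v ∧ ((coreGraph G (rootSet k l₁ l₂)).Adj u v ∨ hasE C u v = true ∨
        (Cls G (rootSet k l₁ l₂) u v ∧ ¬ InPart G (rootSet k l₁ l₂) r u)) := by
  unfold fullG
  have hs : (clsB k (dataOf l₁ l₂) u v && !partB k (dataOf l₁ l₂) r u) =
      (clsB k (dataOf l₁ l₂) v u && !partB k (dataOf l₁ l₂) r v) := by
    rw [Bool.eq_iff_iff]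
    simp only [Bool.and_eq_true, Bool.not_eq_true', ← Bool.not_eq_true (partB _ _ _ _),
      clsB_iff hk hG, partB_iff hk hG]
    exact ⟨fun h => ⟨h.1.symm, fun h' => h.2 (h'.of_cls h.1.symm)⟩,
      fun h => ⟨h.1.symm, fun h' => h.2 (h'.of_cls h.1.symm)⟩⟩
  have hs' : (knownB k (dataOf l₁ l₂) g u v || (hasE C u v ||
      (clsB k (dataOf l₁ l₂) u v && !partB k (dataOf l₁ l₂) r u))) =
      (knownB k (dataOf l₁ l₂) g v u || (hasE C v u ||
      (clsB k (dataOf l₁ l₂) v u && !partB k (dataOf l₁ l₂) r v))) := by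
    rw [hs, knownB_comm, hasE_comm]
  refine (graphOf_edgesOf_adj hs').trans ?_
  simp only [Bool.or_eq_true, Bool.and_eq_true, Bool.not_eq_true',
    ← Bool.not_eq_true (partB _ _ _ _), clsB_iff hk hG, partB_iff hk hG, knownB_iff hk hG hg]

theorem starG_adj (hk : 2 ≤ k) (hG : IsModel k l₁ G) (hg : IsGuess G (rootSet k l₁ l₂) g)
    {u v : Fin n} : (graphOf n (starG k d (dataOf l₁ l₂) g)).Adj u v ↔
      u ≠ v ∧ ((coreGraph G (rootSet k l₁ l₂)).Adj u v ∨
        ∃ r : Fin n, hasE ((collB k d (dataOf l₁ l₂) g r).headD []) u v = true) := by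
  unfold starG
  rw [show (dataOf l₁ l₂).1 = n from rfl, graphOf_edgesOf_adj, Bool.or_eq_true,
    knownB_iff hk hG hg, range_any_iff]
  rw [knownB_comm]
  simp only [hasE_comm (u := (u : ℕ))]

theorem okC_iff {r : ℕ} {C : List (ℕ × ℕ)} : okC k d (dataOf l₁ l₂) g r C = true ↔
    (∀ S ∈ l₁, Cn (graphOf n (fullG k (dataOf l₁ l₂) g r C)) (S : Set (Fin n))) ∧
    (∀ S ∈ l₂, ¬ Cn (graphOf n (emptyG k (dataOf l₁ l₂) g C)) (S : Set (Fin n))) ∧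
    DegLe d (graphOf n (emptyG k (dataOf l₁ l₂) g C)) := by
  have h : degOK d n (emptyG k (dataOf l₁ l₂) g C) = true ↔
    DegLe d (graphOf n (emptyG k (dataOf l₁ l₂) g C)) := degOK_iff
  rw [okC, Bool.and_eq_true, Bool.and_eq_true, show (dataOf l₁ l₂).1 = n from rfl, h]
  simp only [dataOf, List.all_map, List.all_eq_true, Function.comp_apply, Bool.not_eq_true',
    ← Bool.not_eq_true (conG _ _ _), conG_iff]

theorem okG_iff {f : ℕ → ℕ → Bool} : okG d (dataOf l₁ l₂) (edgesOf n f) = true ↔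
    Good d l₁ l₂ (graphOf n (edgesOf n f)) := by
  rw [okG, show (dataOf l₁ l₂).1 = n from rfl, ← bits_univ, Good]
  simp only [Bool.and_eq_true, degOK_iff, conG_iff, Finset.coe_univ, cn_univ_iff]
  simp only [dataOf, List.all_map, List.all_eq_true, Function.comp_apply, Bool.not_eq_true',
    ← Bool.not_eq_true (conG _ _ _), conG_iff]

theorem mem_partList (hk : 2 ≤ k) (hG : IsModel k l₁ G) {r : Fin n} {x : ℕ} :
    x ∈ (List.range n).filter (fun v => partB k (dataOf l₁ l₂) r v) ↔
      ∃ h : x < n, InPart G (rootSet k l₁ l₂) r ⟨x, h⟩ := by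
  rw [List.mem_filter, List.mem_range]
  constructor
  · rintro ⟨h, h'⟩
    exact ⟨h, (partB_iff hk hG (v := ⟨x, h⟩)).1 h'⟩
  · rintro ⟨h, h'⟩
    exact ⟨h, (partB_iff hk hG (v := ⟨x, h⟩)).2 h'⟩

theorem inPart_of_hasE (hk : 2 ≤ k) (hG : IsModel k l₁ G) {r : Fin n} {C : List (ℕ × ℕ)}
    (hC : C ∈ collB k d (dataOf l₁ l₂) g r) {u v : Fin n} (h : hasE C u v = true) :
    InPart G (rootSet k l₁ l₂) r u ∧ InPart G (rootSet k l₁ l₂) r v ∧ u ≠ v := by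
  obtain ⟨h1, h2, h3⟩ := mem_of_hasE (sublist_of_mem_sublistsUpTo (List.mem_of_mem_filter hC)) h
  exact ⟨((mem_partList hk hG).1 h1).2, ((mem_partList hk hG).1 h2).2, fun e => h3 (congrArg _ e)⟩

theorem card_inPart_le (hk : 2 ≤ k) (hG : IsModel k l₁ G) (hd : DegLe d G) (r : Fin n)
    (s : Finset (Fin n)) (hs : ∀ v ∈ s, InPart G (rootSet k l₁ l₂) r v) : s.card ≤ d := by
  rcases s.eq_empty_or_nonempty with rfl | ⟨u, hu⟩
  · simp
  · obtain ⟨z, hz⟩ := exists_common_neighbor hG.1 (cn_rootSet (l₂ := l₂) hk hG).1 (hs u hu).1.1.2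
    exact hd z s fun v hv => hz v ((hs u hu).cls (hs v hv))

/-- `G'` induces on each part a member of its collection. -/
def Matches (k d : ℕ) (l₁ l₂ : List (Finset (Fin n))) (g : List (ℕ × ℕ))
    (G G' : SimpleGraph (Fin n)) : Prop :=
  ∀ r : Fin n, ∃ C ∈ collB k d (dataOf l₁ l₂) g r, ∀ u v, InPart G (rootSet k l₁ l₂) r u →
    InPart G (rootSet k l₁ l₂) r v → (G'.Adj u v ↔ hasE C u v = true)

/-- Members of the collections can be combined freely: whether the given sets are connected and
whether the degrees are small is decided by each part separately. -/
theorem Matches.good (hk : 2 ≤ k) (hG : IsModel k l₁ G) (hg : IsGuess G (rootSet k l₁ l₂) g)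
    (hV : IsVariant G (rootSet k l₁ l₂) G') (hm : Matches k d l₁ l₂ g G G') :
    Good d l₁ l₂ G' := by
  set E := rootSet k l₁ l₂ with hE
  have : Nonempty (Fin n) := hG.1.nonempty
  -- the index of the part that contains `r`, if there is one
  have hidx : ∀ r, ∃ s, ∀ v, Cls G E r v → InPart G E s v := by
    intro r
    by_cases hr : Near G E r
    · exact ⟨r, fun v hv => absurd hr hv.1.1⟩
    · obtain ⟨s, hs⟩ := exists_inPart hr
      exact ⟨s, fun v hv => hs.of_cls hv⟩
  choose idx hidx using hidx
  choose C hC hm using hm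
  have hC' : ∀ r (u v : Fin n), hasE (C r) u v = true → G'.Adj u v := by
    intro r u v h
    obtain ⟨h1, h2, -⟩ := inPart_of_hasE hk hG (hC r) h
    exact (hm r u v h1 h2).2 h
  simp only [collB, List.mem_filter, okC_iff] at hC
  refine ⟨⟨hV.connected hG.1 (cn_rootSet hk hG), fun v s hs => ?_⟩, fun S hS => ?_, fun S hS => ?_⟩
  · refine (hC (idx v)).2.2.2 v s fun u hu => ?_
    rw [emptyG_adj hk hG hg]
    have huv := hs u hu
    refine ⟨huv.ne, ?_⟩
    by_cases hc : Cls G E v u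
    · exact .inr ((hm _ _ _ (hidx v v (Cls.refl hc.1.1)) (hidx v u hc)).1 huv)
    · exact .inl ⟨(hV _ _ hc).1 huv, hc⟩
  · refine hV.cn_of_forall (F := fun r => graphOf n (fullG k (dataOf l₁ l₂) g (idx r) (C (idx r))))
      ?_ fun r => (hC (idx r)).2.1 S hS
    intro r u v huv
    rw [fullG_adj hk hG hg] at huv
    rcases huv.2 with h | h | ⟨h, h'⟩
    · exact .inl (hV.core_le h)
    · exact .inl (hC' _ _ _ h)
    · exact .inr ⟨h, fun hc => h' (hidx r u hc)⟩
  · refine hV.not_cn_of_forall fun r hcn => ?_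
    refine (hC (idx r)).2.2.1 S hS (hcn.mono fun u _ v _ huv => ?_)
    rw [emptyG_adj hk hG hg]
    refine ⟨huv.1.ne, ?_⟩
    by_cases hc : Cls G E u v
    · obtain ⟨_, rfl, hru⟩ := huv.2 hc
      exact .inr ((hm _ _ _ (hidx _ u hru) (hidx _ v (hru.trans hc))).1 huv.1)
    · exact .inl ⟨(hV _ _ hc).1 huv.1, hc⟩

/-- Every good graph induces on each part a member of its collection. -/
theorem Good.matches (hk : 2 ≤ k) (hl : ∀ S, S ∈ l₁ ∨ S ∈ l₂ ↔ S.card = k)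
    (hgood : Good d l₁ l₂ G) (hg : IsGuess G (rootSet k l₁ l₂) g) :
    Matches k d l₁ l₂ g G G := by
  classical
  have hG := hgood.isModel hl
  intro r
  set pl := (List.range n).filter (fun v => partB k (dataOf l₁ l₂) r v) with hpl
  set adj : ℕ → ℕ → Bool := fun u v => decide (∃ (hu : u < n) (hv : v < n), G.Adj ⟨u, hu⟩ ⟨v, hv⟩)
  have hadj : ∀ u v : Fin n, adj u v = true ↔ G.Adj u v := by
    intro u v
    simp [adj]
  have hC : ∀ u v : Fin n, hasE ((pairsOf pl).filter fun e => adj e.1 e.2) u v = true ↔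
      InPart G (rootSet k l₁ l₂) r u ∧ InPart G (rootSet k l₁ l₂) r v ∧ G.Adj u v := by
    intro u v
    rw [hasE_filter_pairsOf (by rw [Bool.eq_iff_iff, hadj, hadj, G.adj_comm]), hpl,
      mem_partList hk hG, mem_partList hk hG, hadj]
    constructor
    · rintro ⟨⟨_, h1⟩, ⟨_, h2⟩, -, h3⟩
      exact ⟨h1, h2, h3⟩
    · rintro ⟨h1, h2, h3⟩
      exact ⟨⟨u.2, h1⟩, ⟨v.2, h2⟩, fun e => h3.ne (Fin.ext e), h3⟩
  refine ⟨(pairsOf pl).filter fun e => adj e.1 e.2, ?_, fun u v hu hv => by simp [hC, hu, hv]⟩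
  have hlen : pl.length ≤ d := by
    rw [hpl, length_filter_range]
    exact card_inPart_le hk hG hgood.1.2 r _ fun v hv => by simpa [partB_iff hk hG] using hv
  have hle : ∀ u v, (graphOf n (emptyG k (dataOf l₁ l₂) g
      ((pairsOf pl).filter fun e => adj e.1 e.2))).Adj u v → G.Adj u v := by
    intro u v huv
    rw [emptyG_adj hk hG hg, hC] at huv
    rcases huv.2 with h | h
    · exact h.1
    · exact h.2.2
  refine List.mem_filter.2 ⟨mem_sublistsUpTo List.filter_sublist
    ((length_pairsOf_le _).trans (Nat.mul_le_mul hlen hlen)), okC_iff.2 ⟨?_, ?_, ?_⟩⟩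
  · refine fun S hS => (hgood.2.1 S hS).mono fun u _ v _ huv => ?_
    rw [fullG_adj hk hG hg]
    refine ⟨huv.ne, ?_⟩
    by_cases hc : Cls G (rootSet k l₁ l₂) u v
    · by_cases hr : InPart G (rootSet k l₁ l₂) r u
      · exact .inr (.inl ((hC u v).2 ⟨hr, hr.of_cls hc, huv⟩))
      · exact .inr (.inr ⟨hc, hr⟩)
    · exact .inl ⟨huv, hc⟩
  · exact fun S hS hcn => hgood.2.2 S hS (hcn.mono fun u _ v _ => hle u v)
  · exact hgood.1.2.mono hle

/-- If there is a good graph with the guessed edges, then the graph formed from the first members of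
the collections is good. -/
theorem Good.star (hk : 2 ≤ k) (hl : ∀ S, S ∈ l₁ ∨ S ∈ l₂ ↔ S.card = k)
    (hgood : Good d l₁ l₂ G) (hg : IsGuess G (rootSet k l₁ l₂) g) :
    okG d (dataOf l₁ l₂) (starG k d (dataOf l₁ l₂) g) = true := by
  have hG := hgood.isModel hl
  refine okG_iff.2 ?_
  change Good d l₁ l₂ (graphOf n (starG k d (dataOf l₁ l₂) g))
  have hhead : ∀ r : Fin n, (collB k d (dataOf l₁ l₂) g r).headD [] ∈
      collB k d (dataOf l₁ l₂) g r := by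
    intro r
    obtain ⟨C, hC, -⟩ := hgood.matches hk hl hg r
    obtain ⟨C', l, e⟩ := List.exists_cons_of_ne_nil (List.ne_nil_of_mem hC)
    simp [e]
  refine Matches.good hk hG hg ?_ ?_
  · intro u v huv
    rw [starG_adj hk hG hg]
    constructor
    · rintro ⟨-, h | ⟨r, h⟩⟩
      · exact h.1
      · obtain ⟨h1, h2, -⟩ := inPart_of_hasE hk hG (hhead r) h
        exact absurd (h1.cls h2) huv
    · exact fun h => ⟨h.ne, .inl ⟨h, huv⟩⟩
  · intro r
    refine ⟨_, hhead r, fun u v hu hv => ?_⟩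
    rw [starG_adj hk hG hg]
    constructor
    · rintro ⟨-, h | ⟨s, h⟩⟩
      · exact absurd (hu.cls hv) h.2
      · obtain ⟨h1, h2, -⟩ := inPart_of_hasE hk hG (hhead s) h
        rwa [hu.index_eq h1]
    · exact fun h => ⟨(inPart_of_hasE hk hG (hhead r) h).2.2, .inr ⟨r, h⟩⟩

/-- A choice of edges near the root set that passes the test comes from a good graph. -/
theorem exists_good_of_mem_guesses (hk : 2 ≤ k) (hl : ∀ S, S ∈ l₁ ∨ S ∈ l₂ ↔ S.card = k) {b : ℕ}
    (hg : g ∈ guesses k d b (dataOf l₁ l₂)) :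
    ∃ G, Good d l₁ l₂ G ∧ IsGuess G (rootSet k l₁ l₂) g := by
  obtain ⟨hg1, hg2⟩ := List.mem_filter.1 hg
  have hgood : Good d l₁ l₂ (graphOf n (starG k d (dataOf l₁ l₂) g)) := okG_iff.1 hg2
  refine ⟨_, hgood, fun u v => ?_⟩
  have hG := hgood.isModel hl
  have hsub := sublist_of_mem_sublistsUpTo hg1
  have hadj : (graphOf n (starG k d (dataOf l₁ l₂) g)).Adj u v ↔ u ≠ v ∧
      (knownB k (dataOf l₁ l₂) g u v || (List.range n).any fun r =>
        hasE ((collB k d (dataOf l₁ l₂) g r).headD []) u v) = true := by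
    refine graphOf_edgesOf_adj ?_
    rw [knownB_comm]
    simp only [hasE_comm (u := (u : ℕ))]
  constructor
  · intro h
    obtain ⟨h1, h2, h3⟩ := mem_of_hasE hsub h
    refine ⟨(near_iff hk hG).1 (List.mem_filter.1 h1).2,
      (near_iff hk hG).1 (List.mem_filter.1 h2).2,
      hadj.2 ⟨fun e => h3 (congrArg _ e), ?_⟩⟩
    simp [knownB, h]
  · rintro ⟨hu, hv, h⟩
    have h := (hadj.1 h).2
    simp only [knownB, Bool.or_eq_true, evB_iff hk hG, range_any_iff] at h
    rcases h with (h | h | h) | ⟨r, h⟩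
    · exact h
    · exact absurd hu h.1
    · exact absurd hv h.1
    · exfalso
      rcases hc : collB k d (dataOf l₁ l₂) g r with _ | ⟨C, l⟩
      · simp [hc, hasE] at h
      · rw [hc, List.headD_cons] at h
        have := inPart_of_hasE hk hG (hc ▸ List.mem_cons_self) h
        exact this.1.1.1.2 hu

theorem card_near_le (hk : 2 ≤ k) (hl : ∀ S, S ∈ l₁ ∨ S ∈ l₂ ↔ S.card = k)
    (hgood : Good d l₁ l₂ G) (s : Finset (Fin n))
    (hs : ∀ v ∈ s, Near G (rootSet k l₁ l₂) v) : s.card ≤ k + k * d := by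
  classical
  have hG := hgood.isModel hl
  obtain ⟨E, hE, e⟩ : ∃ E : Finset (Fin n), E.card ≤ k ∧ rootSet k l₁ l₂ = E := by
    rcases rootSet_cases (l₂ := l₂) hk hG with ⟨h, e⟩ | ⟨S, h, -, e⟩
    · exact ⟨Finset.univ, by simpa using h.le, by simpa using e⟩
    · exact ⟨S, h.le, e⟩
  rw [e] at hs
  have hsub : s ⊆ E ∪ E.biUnion fun e => s.filter fun v => G.Adj e v := by
    intro v hv
    rcases hs v hv with h | ⟨a, h, h'⟩
    · exact Finset.mem_union_left _ h
    · exact Finset.mem_union_right _ (Finset.mem_biUnion.2 ⟨a, h, by simp [hv, h']⟩)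
  refine (Finset.card_le_card hsub).trans ((Finset.card_union_le _ _).trans ?_)
  have h1 : (E.biUnion fun e => s.filter fun v => G.Adj e v).card ≤ E.card * d :=
    Finset.card_biUnion_le_card_mul _ _ _ fun a _ => hgood.1.2 a _ fun u hu => by simp_all
  have h2 := Nat.mul_le_mul_right d hE
  omega

/-- The edges of a good graph near the root set are among the choices tried. -/
theorem Good.exists_guess (hk : 2 ≤ k) (hl : ∀ S, S ∈ l₁ ∨ S ∈ l₂ ↔ S.card = k)
    (hgood : Good d l₁ l₂ G) : ∃ g ∈ guesses k d ((k + k * d) * (k + k * d)) (dataOf l₁ l₂),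
      IsGuess G (rootSet k l₁ l₂) g := by
  classical
  have hG := hgood.isModel hl
  set nl := (List.range n).filter (fun v => near k (dataOf l₁ l₂) v) with hnl
  have hmem : ∀ u : Fin n, (u : ℕ) ∈ nl ↔ Near G (rootSet k l₁ l₂) u := by
    intro u
    simp [hnl, near_iff hk hG]
  set adj : ℕ → ℕ → Bool := fun u v => decide (∃ (hu : u < n) (hv : v < n), G.Adj ⟨u, hu⟩ ⟨v, hv⟩)
  have hadj : ∀ u v : Fin n, adj u v = true ↔ G.Adj u v := by
    intro u v
    simp [adj]
  have hg : IsGuess G (rootSet k l₁ l₂) ((pairsOf nl).filter fun e => adj e.1 e.2) := by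
    intro u v
    rw [hasE_filter_pairsOf (by rw [Bool.eq_iff_iff, hadj, hadj, G.adj_comm]), hmem, hmem, hadj]
    constructor
    · rintro ⟨h1, h2, -, h3⟩
      exact ⟨h1, h2, h3⟩
    · rintro ⟨h1, h2, h3⟩
      exact ⟨h1, h2, fun e => h3.ne (Fin.ext e), h3⟩
  refine ⟨_, List.mem_filter.2 ⟨mem_sublistsUpTo List.filter_sublist ?_, hgood.star hk hl hg⟩, hg⟩
  have hlen : nl.length ≤ k + k * d := by
    rw [hnl, length_filter_range]
    exact card_near_le hk hl hgood _ fun v hv => by simpa [near_iff hk hG] using hv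
  exact (length_pairsOf_le _).trans (Nat.mul_le_mul hlen hlen)

/-- All good graphs with the same edges near the root set are variants of each other, and induce
on the parts members of the collections. -/
theorem Good.variant (hk : 2 ≤ k) (hl : ∀ S, S ∈ l₁ ∨ S ∈ l₂ ↔ S.card = k)
    (hgood : Good d l₁ l₂ G) (hgood' : Good d l₁ l₂ G') (hg : IsGuess G (rootSet k l₁ l₂) g)
    (hg' : IsGuess G' (rootSet k l₁ l₂) g) :
    IsVariant G (rootSet k l₁ l₂) G' ∧ Matches k d l₁ l₂ g G G' := by
  have hG := hgood.isModel hl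
  have hG' := hgood'.isModel hl
  have hcls : ∀ u v, Cls G' (rootSet k l₁ l₂) u v ↔ Cls G (rootSet k l₁ l₂) u v := fun u v => by
    rw [← clsB_iff (l₂ := l₂) hk hG, ← clsB_iff (l₂ := l₂) hk hG']
  have hpart : ∀ r v, InPart G' (rootSet k l₁ l₂) r v ↔ InPart G (rootSet k l₁ l₂) r v :=
    fun r v => by rw [← partB_iff (l₂ := l₂) hk hG, ← partB_iff (l₂ := l₂) hk hG']
  constructor
  · intro u v huv
    have h := (knownB_iff hk hG hg (u := u) (v := v)).symm.trans (knownB_iff hk hG' hg')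
    simp only [coreGraph, hcls, huv, not_false_eq_true, and_true] at h
    exact h.symm
  · have := hgood'.matches hk hl hg'
    simpa only [Matches, hpart] using this

end

/-! ### The output -/

section
variable {n k d : ℕ} {l₁ l₂ : List (Finset (Fin n))} {G G' : SimpleGraph (Fin n)}
  {g : List (ℕ × ℕ)}

theorem encodeList_map {α β : Type} (f : β → Data) (h : α → β) (l : List α) :
    encodeList f (l.map h) = encodeList (fun a => f (h a)) l := by
  induction l with
  | nil => rfl
  | cons a l ih => simp only [List.map_cons, encodeList, ih]

theorem encodeList_congr {α : Type} {f h : α → Data} {l : List α} (hfh : ∀ a ∈ l, f a = h a) :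
    encodeList f l = encodeList h l := by
  induction l with
  | nil => rfl
  | cons a l ih =>
    simp only [encodeList, hfh a List.mem_cons_self,
      ih fun b hb => hfh b (List.mem_cons_of_mem _ hb)]

theorem enc_map_range {β : Type} [Enc β] (f : ℕ → β) :
    enc ((List.range n).map f) = encodeList (fun v : Fin n => enc (f v)) (List.finRange n) := by
  rw [← List.map_coe_finRange_eq_range, List.map_map]
  exact encodeList_map _ _ _

theorem enc_bits (S : Finset (Fin n)) : enc (bits S) = encodeSet S :=
  encodeList_map _ _ _

theorem encodeSet_eq {S : Finset (Fin n)} {f : ℕ → Bool} (h : ∀ v : Fin n, f v = true ↔ v ∈ S) :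
    encodeSet S = enc ((List.range n).map f) := by
  rw [enc_map_range]
  refine encodeList_congr fun v _ => congrArg encodeBool ?_
  rw [Bool.eq_iff_iff, h, decide_eq_true_eq]

open Classical in
theorem encodeGraph_eq {f : ℕ → ℕ → Bool} (h : ∀ u v : Fin n, f u v = true ↔ G.Adj u v) :
    encodeGraph G = enc (mat n f) := by
  rw [mat, enc_map_range]
  refine encodeList_congr fun u _ => ?_
  rw [enc_map_range]
  refine encodeList_congr fun v _ => congrArg encodeBool ?_
  rw [Bool.eq_iff_iff, h, decide_eq_true_eq]

open Classical in
/-- The skeleton whose parts are the classes of `G`, with the edges outside the parts taken from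
`G` and with the collections given as lists of edge lists. A class is listed at its smallest
element, and the parts at all other indices are empty. -/
noncomputable def skeletonOf (G : SimpleGraph (Fin n)) (E : Set (Fin n))
    (L : Fin n → List (List (ℕ × ℕ))) : Skeleton (Fin n) where
  edges := coreGraph G E
  nonEdges :=
    { Adj := fun u v => u ≠ v ∧ ¬ (coreGraph G E).Adj u v ∧ ¬ Cls G E u v
      symm := ⟨fun _ _ h => ⟨h.1.symm, fun h' => h.2.1 h'.symm, fun h' => h.2.2 h'.symm⟩⟩
      loopless := ⟨fun _ h => h.1 rfl⟩ }
  unknown :=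
    { Adj := fun u v => u ≠ v ∧ Cls G E u v
      symm := ⟨fun _ _ h => ⟨h.1.symm, h.2.symm⟩⟩
      loopless := ⟨fun _ h => h.1 rfl⟩ }
  edges_disjoint_nonEdges := by
    rw [disjoint_iff_inf_le]
    exact fun u v h => h.2.2.1 h.1
  edges_disjoint_unknown := by
    rw [disjoint_iff_inf_le]
    exact fun u v h => h.1.2 h.2.2
  nonEdges_disjoint_unknown := by
    rw [disjoint_iff_inf_le]
    exact fun u v h => h.1.2.2 h.2.2
  cover := by
    ext u v
    simp only [SimpleGraph.sup_adj, SimpleGraph.top_adj]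
    constructor
    · rintro ((h | h) | h)
      · exact h.ne
      · exact h.1
      · exact h.1
    · intro h
      by_cases hc : Cls G E u v
      · exact .inr ⟨h, hc⟩
      · by_cases ha : (coreGraph G E).Adj u v
        · exact .inl (.inl ha)
        · exact .inl (.inr ⟨h, ha, hc⟩)
  m := n
  part r := Finset.univ.filter fun v => InPart G E r v
  parts_disjoint r s hrs := by
    rw [Finset.disjoint_filter]
    exact fun v _ h h' => hrs (h.index_eq h')
  unknown_adj_iff u v := by
    refine and_congr_right fun _ => ?_
    simp only [Finset.mem_filter, Finset.mem_univ, true_and]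
    constructor
    · intro h
      obtain ⟨r, hr⟩ := exists_inPart h.1.1
      exact ⟨r, hr, hr.of_cls h⟩
    · rintro ⟨r, hu, hv⟩
      exact hu.cls hv
  collection r := {C | ∃ es ∈ L r, C = (graphOf n es).induce _}

theorem skeletonOf_isCompletion {E : Set (Fin n)} {L : Fin n → List (List (ℕ × ℕ))} :
    (skeletonOf G E L).IsCompletion G' ↔ IsVariant G E G' ∧ ∀ r, ∃ C ∈ L r, ∀ u v,
      InPart G E r u → InPart G E r v → (G'.Adj u v ↔ u ≠ v ∧ hasE C u v = true) := by
  have hsuper : (skeletonOf G E L).toPartialGraph.IsSupergraph G' ↔ IsVariant G E G' := by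
    constructor
    · rintro ⟨h1, h2⟩ u v huv
      constructor
      · intro h
        by_contra hn
        exact (h2 (show (skeletonOf G E L).nonEdges.Adj u v from
          ⟨h.ne, fun h' => hn h'.1, huv⟩)).2 h
      · exact fun h => h1 ⟨h, huv⟩
    · refine fun h => ⟨fun u v huv => h.core_le huv, fun u v huv => ⟨huv.1, fun h' => ?_⟩⟩
      exact huv.2.1 ⟨(h u v huv.2.2).1 h', huv.2.2⟩
  have hpart : ∀ (r : Fin n) (C : List (ℕ × ℕ)),
      G'.induce ((skeletonOf G E L).part r : Set (Fin n)) = (graphOf n C).induce _ ↔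
      ∀ u v, InPart G E r u → InPart G E r v → (G'.Adj u v ↔ u ≠ v ∧ hasE C u v = true) := by
    intro r C
    have hmem : ∀ v, v ∈ ((skeletonOf G E L).part r : Set (Fin n)) ↔ InPart G E r v := by
      intro v
      simp [skeletonOf]
    constructor
    · intro h u v hu hv
      have := congrArg (fun H : SimpleGraph _ => H.Adj ⟨u, (hmem u).2 hu⟩ ⟨v, (hmem v).2 hv⟩) h
      exact iff_of_eq this
    · intro h
      ext ⟨u, hu⟩ ⟨v, hv⟩
      exact h u v ((hmem u).1 hu) ((hmem v).1 hv)
  constructor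
  · rintro ⟨C, hC, hs, hC'⟩
    refine ⟨hsuper.1 hs, fun r => ?_⟩
    obtain ⟨es, hes, h⟩ := hC r
    exact ⟨es, hes, (hpart r es).1 ((hC' r).trans h)⟩
  · rintro ⟨hs, h⟩
    choose C hC h using h
    exact ⟨fun r => (graphOf n (C r)).induce _, fun r => ⟨C r, hC r, rfl⟩, hsuper.2 hs,
      fun r => (hpart r (C r)).2 (h r)⟩

theorem skeletonOf_isEncoding (hk : 2 ≤ k) (hG : IsModel k l₁ G)
    (hg : IsGuess G (rootSet k l₁ l₂) g) :
    (skeletonOf G (rootSet k l₁ l₂) fun r => collB k d (dataOf l₁ l₂) g r).IsEncoding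
      (enc (outB k d (dataOf l₁ l₂) g)) := by
  set E := rootSet k l₁ l₂ with hE
  set s := skeletonOf G E fun r => collB k d (dataOf l₁ l₂) g r with hs
  have hne : ∀ u v : Fin n, (!((u : ℕ) == v)) = true ↔ u ≠ v := by
    intro u v
    simp [Fin.val_inj]
  have hmem : ∀ r v, v ∈ s.part r ↔ InPart G E r v := by
    intro r v
    classical exact Finset.mem_filter_univ v
  refine ⟨fun r => (collB k d (dataOf l₁ l₂) g (r : Fin n)).map
    fun es => (graphOf n es).induce _, fun r C => ?_, ?_⟩
  · rw [List.mem_map]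
    exact ⟨fun ⟨es, h, e⟩ => ⟨es, h, e.symm⟩, fun ⟨es, h, e⟩ => ⟨es, h, e.symm⟩⟩
  · have h1 : encodeGraph s.edges =
        enc (mat n fun u v => !(u == v) && knownB k (dataOf l₁ l₂) g u v) := by
      refine encodeGraph_eq fun u v => ?_
      rw [Bool.and_eq_true, hne, knownB_iff hk hG hg]
      exact ⟨fun h => h.2, fun h => ⟨h.ne, h⟩⟩
    have h2 : encodeGraph s.nonEdges = enc (mat n fun u v => !(u == v) &&
        !(knownB k (dataOf l₁ l₂) g u v || clsB k (dataOf l₁ l₂) u v)) := by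
      refine encodeGraph_eq fun u v => ?_
      rw [Bool.and_eq_true, hne, Bool.not_eq_true', ← Bool.not_eq_true, Bool.or_eq_true,
        knownB_iff hk hG hg, clsB_iff hk hG, not_or]
      rfl
    have h3 : encodeGraph s.unknown =
        enc (mat n fun u v => !(u == v) && clsB k (dataOf l₁ l₂) u v) := by
      refine encodeGraph_eq fun u v => ?_
      rw [Bool.and_eq_true, hne, clsB_iff hk hG]
      rfl
    have h4 : enc ((List.range n).map fun r => ((List.range n).map fun v =>
        partB k (dataOf l₁ l₂) r v, (collB k d (dataOf l₁ l₂) g r).map fun C =>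
          mat n fun u v => hasE C u v)) =
        encodeList (fun r : Fin n => .cons (encodeSet (s.part r)) (encodeList encodeGraphOn
          ((collB k d (dataOf l₁ l₂) g r).map fun es =>
            (graphOf n es).induce (s.part r : Set (Fin n))))) (List.finRange n) := by
      rw [enc_map_range]
      refine encodeList_congr fun r _ => ?_
      refine congrArg₂ Data.cons ?_ ?_
      · exact (encodeSet_eq fun v => (partB_iff hk hG).trans (hmem r v).symm).symm
      · rw [encodeList_map]
        refine (encodeList_map _ _ _).trans (encodeList_congr fun es hes => ?_)
        refine (encodeGraph_eq fun u v => ?_).symm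
        rw [SimpleGraph.map_adj]
        constructor
        · intro h
          obtain ⟨hu, hv, huv⟩ := inPart_of_hasE hk hG hes h
          exact ⟨⟨u, (hmem r u).2 hu⟩, ⟨v, (hmem r v).2 hv⟩, ⟨huv, h⟩, rfl, rfl⟩
        · rintro ⟨⟨u, hu⟩, ⟨v, hv⟩, h, rfl, rfl⟩
          exact h.2
    change Data.cons (.cons (enc (mat n _)) (.cons (enc (mat n _)) (enc (mat n _)))) (enc _) = _
    rw [encodePartialGraph, h1, h2, h3]
    exact congrArg _ h4

/-- For each choice of edges that passes the test, the output is a skeleton of width at most `d`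
whose completions are the good graphs with these edges. -/
theorem exists_skeleton_of_mem_guesses (hk : 2 ≤ k)
    (hl : ∀ S, S ∈ l₁ ∨ S ∈ l₂ ↔ S.card = k) {b : ℕ} (hg : g ∈ guesses k d b (dataOf l₁ l₂)) :
    ∃ s : Skeleton (Fin n), s.IsEncoding (enc (outB k d (dataOf l₁ l₂) g)) ∧ s.width ≤ d ∧
      (∀ G, s.IsCompletion G → Good d l₁ l₂ G) ∧
      ∀ G, Good d l₁ l₂ G → IsGuess G (rootSet k l₁ l₂) g → s.IsCompletion G := by
  obtain ⟨G, hgood, hgG⟩ := exists_good_of_mem_guesses hk hl hg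
  have hG := hgood.isModel hl
  have hne : ∀ {G' : SimpleGraph (Fin n)} {r : Fin n}, ∀ C ∈ collB k d (dataOf l₁ l₂) g r,
      ∀ u v : Fin n, (G'.Adj u v ↔ u ≠ v ∧ hasE C u v = true) ↔
        (G'.Adj u v ↔ hasE C u v = true) := by
    intro G' r C hC u v
    rw [and_iff_right_of_imp fun h => (inPart_of_hasE hk hG hC h).2.2]
  refine ⟨_, skeletonOf_isEncoding hk hG hgG, ?_, fun G' h => ?_, fun G' h hg' => ?_⟩
  · refine Finset.sup_le fun r _ => card_inPart_le (l₂ := l₂) hk hG hgood.1.2 r _ fun v hv => ?_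
    simpa [skeletonOf] using hv
  · obtain ⟨hV, hm⟩ := skeletonOf_isCompletion.1 h
    refine Matches.good hk hG hgG hV fun r => ?_
    obtain ⟨C, hC, h⟩ := hm r
    exact ⟨C, hC, fun u v hu hv => (hne C hC u v).1 (h u v hu hv)⟩
  · obtain ⟨hV, hm⟩ := hgood.variant hk hl h hgG hg'
    refine skeletonOf_isCompletion.2 ⟨hV, fun r => ?_⟩
    obtain ⟨C, hC, h⟩ := hm r
    exact ⟨C, hC, fun u v hu hv => (hne C hC u v).2 (h u v hu hv)⟩

/-! ### The size of the input -/

theorem esize_bits_le (S : Finset (Fin n)) : esize (bits S) ≤ 4 * n + 1 := by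
  have key : ∀ l : List Bool, esize l ≤ 4 * l.length + 1 := by
    intro l
    induction l with
    | nil => simp
    | cons a l ih =>
      have := esize_bool_le a
      simp only [esize_cons, List.length_cons]
      omega
  simpa [bits] using key (bits S)

theorem esize_map_bits_le {l : List (Finset (Fin n))} (hl : l.Nodup)
    (hc : ∀ S ∈ l, S.card = k) : esize (l.map bits) ≤ n ^ k * (4 * n + 2) + 1 := by
  have h1 : l.length ≤ n ^ k := by
    rw [← List.toFinset_card_of_nodup hl]
    have hsub : l.toFinset ⊆ Finset.powersetCard k Finset.univ := by
      intro S hS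
      simp [Finset.mem_powersetCard, hc S (List.mem_toFinset.1 hS)]
    refine (Finset.card_le_card hsub).trans ?_
    rw [Finset.card_powersetCard, Finset.card_univ, Fintype.card_fin]
    exact Nat.choose_le_pow n k
  have h2 : esize (l.map bits) ≤ l.length * (4 * n + 2) + 1 := by
    clear hl hc h1
    induction l with
    | nil => simp
    | cons S l ih =>
      have := esize_bits_le S
      simp only [List.map_cons, esize_cons, List.length_cons, Nat.add_mul]
      omega
  exact h2.trans (Nat.add_le_add_right (Nat.mul_le_mul_right _ h1) 1)

end

theorem good_iff {k d n : ℕ} {K : CompleteKSets k (Fin n)} {l₁ l₂ : List (Finset (Fin n))}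
    (h₁ : ∀ S, S ∈ l₁ ↔ S ∈ K.conn) (h₂ : ∀ S, S ∈ l₂ ↔ S ∈ K.disconn)
    (G : SimpleGraph (Fin n)) [DecidableRel G.Adj] :
    G.Connected ∧ G.maxDegree ≤ d ∧ K.Consistent G ↔ Good d l₁ l₂ G := by
  have hK : K.Consistent G ↔ (∀ S ∈ l₁, Cn G (S : Set (Fin n))) ∧
      ∀ S ∈ l₂, ¬ Cn G (S : Set (Fin n)) := by
    simp only [h₁, h₂, CompleteKSets.Consistent, connectedSets, disconnectedSets, Set.ext_iff,
      Set.mem_ofPred_eq, Finset.mem_coe, ← cn_iff_connected]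
    constructor
    · exact fun h => ⟨fun S hS => ((h.1 S).2 hS).2, fun S hS => ((h.2 S).2 hS).2⟩
    · refine fun h => ⟨fun S => ⟨fun hS => ?_, fun hS => ?_⟩, fun S => ⟨fun hS => ?_, fun hS => ?_⟩⟩
      · exact ((K.cover S).2 hS.1).resolve_right fun h' => h.2 S h' hS.2
      · exact ⟨(K.cover S).1 (.inl hS), h.1 S hS⟩
      · exact ((K.cover S).2 hS.1).resolve_left fun h' => hS.2 (h.1 S h')
      · exact ⟨(K.cover S).1 (.inr hS), h.2 S hS⟩
  rw [hK, degLe_iff_maxDegree, Good, and_assoc]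

theorem mainTheorem3 (k d : ℕ) (hk : 2 ≤ k) (hd : 1 ≤ d) :
    ∃ (P : Program) (p : Polynomial ℕ) (N : ℕ),
      ∀ (n : ℕ) (K : CompleteKSets k (Fin n)) (x : Data), K.IsEncoding x →
        ∃ (F : List (Skeleton (Fin n))) (y : Data) (t : ℕ),
          P.Runs x y t ∧ t ≤ p.eval n ∧ IsFamilyEncoding F y ∧
          F.length ≤ N ∧ (∀ s ∈ F, s.width ≤ d) ∧
          ∀ (G : SimpleGraph (Fin n)) [DecidableRel G.Adj],
            (G.Connected ∧ G.maxDegree ≤ d ∧ K.Consistent G) ↔ ∃ s ∈ F, s.IsCompletion G := by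
  set b := (k + k * d) * (k + k * d) with hb
  obtain ⟨P, p, hP⟩ := PolyTime.algorithm k d b
  refine ⟨P, p.comp (.X * 2 + .C 1 + (.X ^ k * (.C 4 * .X + .C 2) + .C 1) * .C 2 + .C 2), 2 ^ b,
    fun n K x hx => ?_⟩
  obtain ⟨l₁, l₂, hn₁, hn₂, h₁, h₂, rfl⟩ := hx
  have hl : ∀ S, S ∈ l₁ ∨ S ∈ l₂ ↔ S.card = k := fun S => by rw [h₁, h₂, K.cover]
  have hx : Data.cons (encodeNat n) (.cons (encodeList encodeSet l₁) (encodeList encodeSet l₂)) =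
      enc (dataOf l₁ l₂) := by
    have : ∀ l : List (Finset (Fin n)), encodeList encodeSet l = enc (l.map bits) := fun l =>
      ((encodeList_map _ _ _).trans (encodeList_congr fun S _ => enc_bits S)).symm
    rw [this, this]
    rfl
  obtain ⟨t, ht, htp⟩ := hP (dataOf l₁ l₂)
  choose s hs using fun (g : {g // g ∈ guesses k d b (dataOf l₁ l₂)}) =>
    exists_skeleton_of_mem_guesses hk hl g.2
  refine ⟨(guesses k d b (dataOf l₁ l₂)).attach.map s, _, t, by rw [hx]; exact ht, htp.trans ?_,
    ⟨(guesses k d b (dataOf l₁ l₂)).map fun g => enc (outB k d (dataOf l₁ l₂) g), ?_, ?_⟩,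
    ?_, ?_, ?_⟩
  · rw [Polynomial.eval_comp]
    refine p.eval_nat_mono ?_
    have e₁ := esize_map_bits_le hn₁ fun S hS => (hl S).1 (.inl hS)
    have e₂ := esize_map_bits_le hn₂ fun S hS => (hl S).1 (.inr hS)
    simp only [dataOf, esize_prod, PolyTime.esize_nat, Polynomial.eval_add, Polynomial.eval_mul,
      Polynomial.eval_pow, Polynomial.eval_X, Polynomial.eval_C, Polynomial.eval_ofNat] at *
    omega
  · have e := congrArg (List.map fun g => enc (outB k d (dataOf l₁ l₂) g))
      (List.attach_map_subtype_val (guesses k d b (dataOf l₁ l₂)))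
    rw [← e, List.map_map, List.forall₂_map_left_iff, List.forall₂_map_right_iff,
      List.forall₂_same]
    exact fun g _ => (hs g).1
  · change encodeList enc _ = _
    rw [encodeList_map, encodeList_map]
  · rw [List.length_map, List.length_attach]
    exact (List.length_filter_le _ _).trans (length_sublistsUpTo_le _ _)
  · intro s' hs'
    obtain ⟨g, -, rfl⟩ := List.mem_map.1 hs'
    exact (hs g).2.1
  · intro G _
    rw [good_iff h₁ h₂]
    constructor
    · intro h
      obtain ⟨g, hg, hgG⟩ := h.exists_guess hk hl
      exact ⟨_, List.mem_map_of_mem (List.mem_attach _ ⟨g, hg⟩), (hs ⟨g, hg⟩).2.2.2 G h hgG⟩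
    · rintro ⟨s', hs', h⟩
      obtain ⟨g, -, rfl⟩ := List.mem_map.1 hs'
      exact (hs g).2.2.1 G h
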